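/- Let $\varepsilon,\gamma$ be nonzero real numbers and consider the two-dimensional viscoelastic equation $$u_{tt}-\varepsilon\,\partial_t\Delta u-\gamma\,\Delta u=f,\qquad \Delta=\partial_x^2+\partial_y^2,$$ with independent variables $x,y,t$ and dependent variables $u,f$. Write $L\alpha=\alpha_{tt}-\varepsilon\,\partial_t\Delta\alpha-\gamma\,\Delta\alpha$ and consider on $\mathbb R^5=\{(x,y,t,u,f)\}$ the vector fields $$X_1=\partial_x,\quad X_2=\partial_y,\quad X_3=\partial_t,\quad X_4=y\,\partial_x-x\,\partial_y,\quad X_5=u\,\partial_u+f\,\partial_f,\quad X_\alpha=\alpha\,\partial_u+(L\alpha)\,\partial_f,$$ where $\alpha=\alpha(x,y,t)$ is an arbitrary smooth function. 1. A smooth vector field $V$ on $\mathbb R^5$ satisfies the infinitesimal invariance condition $$\mathrm{Pr}^{(3)}V\,[u_{tt}-\varepsilon(u_{xxt}+u_{yyt})-\gamma(u_{xx}+u_{yy})-f]=0\quad\text{whenever}\quad u_{tt}-\varepsilon(u_{xxt}+u_{yyt})-\gamma(u_{xx}+u_{yy})-f=0$$ if and only if $V=\sum_{i=1}^5c_iX_i+X_\alpha$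 for some $c_1,\dots,c_5\in\mathbb R$ and some smooth $\alpha$. 2. Let $(\Phi_s)$ be a smooth local one-parameter group of transformations of $\mathbb R^5$ that is a group of point symmetries of the equation, that is: whenever some $\Phi_s$ carries the graph of a smooth solution $(u,f)$ on an open subset of $\mathbb R^3$ onto the graph of a pair of smooth functions on an open subset of $\mathbb R^3$, this pair is again a solution. Then its infinitesimal generator is $\sum_{i=1}^5c_iX_i+X_\alpha$ for some $c_1,\dots,c_5\in\mathbb R$ and some smooth $\alpha$. 3. Each of $X_1,\dots,X_5$, and $X_\alpha$ for every smooth $\alpha$, generates a global one-parameter group of point symmetries of the equation. 4. For smooth $\alpha$, the vector field $\alpha\,\partial_u$ satisfies the infinitesimal invariance condition if and only if $L\alpha=0$ (and then $X_\alpha=\alpha\,\partial_u$). 5. The commutators $[X_i,X_j]=X_iX_j-X_jX_i$, $1\le i,j\le5$, are $[X_1,X_4]=-X_2=-[X_4,X_1]$, $[X_2,X_4]=X_1=-[X_4,X_2]$, and all others vanish. -/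

import Mathlib

open scoped ContDiff

namespace Viscoelastic

/-- The space of independent variables; the coordinates `0, 1, 2` are `x, y, t`. -/
abbrev Base : Type := Fin 3 → ℝ

/-- The space of independent and dependent variables: `((x, y, t), u, f)`. -/
abbrev Total : Type := Base × ℝ × ℝ

/-- The partial derivative with respect to the `i`-th independent variable. -/
noncomputable def pd (i : Fin 3) (g : Base → ℝ) : Base → ℝ :=
  fun z => fderiv ℝ g z (Pi.single i 1)

/-- Iterated partial derivatives: `pds [i, j, k] g = ∂ᵢ ∂ⱼ ∂ₖ g`. -/
noncomputable def pds (J : List (Fin 3)) (g : Base → ℝ) : Base → ℝ :=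
  J.foldr pd g

/-- The Laplacian in the two space variables `x, y`. -/
noncomputable def laplacian (u : Base → ℝ) : Base → ℝ :=
  fun z => pd 0 (pd 0 u) z + pd 1 (pd 1 u) z

/-- The left hand side `u_tt - ε ∂_t (Δ u) - γ Δ u` of the viscoelastic equation. -/
noncomputable def viscoOp (ε γ : ℝ) (u : Base → ℝ) : Base → ℝ :=
  fun z => pd 2 (pd 2 u) z - ε * pd 2 (laplacian u) z - γ * laplacian u z

/-- `(u, f)` is a smooth solution of `u_tt - ε ∂_t (Δ u) - γ Δ u = f` on the set `Ω`
(used for open `Ω`). -/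
def IsSolutionOn (ε γ : ℝ) (u f : Base → ℝ) (Ω : Set Base) : Prop :=
  ContDiffOn ℝ ∞ u Ω ∧ ContDiffOn ℝ ∞ f Ω ∧ ∀ z ∈ Ω, viscoOp ε γ u z = f z

/-- The graph of the pair `(u, f)` over `Ω`. -/
def graphOver (u f : Base → ℝ) (Ω : Set Base) : Set Total :=
  (fun z => (z, u z, f z)) '' Ω

/-! ### Infinitesimal symmetries -/

/-- The characteristic `Q = φ₁ - ∑ᵢ ξⁱ uᵢ` of the vector field
`V = ∑ᵢ ξⁱ ∂_{xⁱ} + φ₁ ∂_u + φ₂ ∂_f`, evaluated along the pair of functions `(u, f)`. -/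
noncomputable def characteristicU (V : Total → Total) (u f : Base → ℝ) : Base → ℝ :=
  fun z => (V (z, u z, f z)).2.1 - ∑ i, (V (z, u z, f z)).1 i * pd i u z

/-- The coefficient `φ₁^J = D_J Q + ∑ᵢ ξⁱ u_{J,i}` of `∂/∂u_J` in the prolongation of `V`,
evaluated at the jet of `(u, f)` at `z`. Total derivatives evaluated along `(u, f)` are partial
derivatives of the composite function. -/
noncomputable def prolongU (V : Total → Total) (J : List (Fin 3)) (u f : Base → ℝ) (z : Base) : ℝ :=
  pds J (characteristicU V u f) z + ∑ i, (V (z, u z, f z)).1 i * pd i (pds J u) z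

/-- `Pr⁽³⁾V [u_tt - ε (u_xxt + u_yyt) - γ (u_xx + u_yy) - f]`, evaluated at the 3-jet of `(u, f)`
at `z`. -/
noncomputable def prolongEquation (ε γ : ℝ) (V : Total → Total) (u f : Base → ℝ) (z : Base) : ℝ :=
  prolongU V [2, 2] u f z
    - ε * (prolongU V [2, 0, 0] u f z + prolongU V [2, 1, 1] u f z)
    - γ * (prolongU V [0, 0] u f z + prolongU V [1, 1] u f z)
    - (V (z, u z, f z)).2.2

/-- The infinitesimal invariance condition: the third prolongation of `V` annihilates the equation
at every 3-jet that satisfies the equation. (Every 3-jet is the jet of a pair of smooth functions;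
the equation is only required at the point `z`.) -/
def IsInfinitesimalSymmetry (ε γ : ℝ) (V : Total → Total) : Prop :=
  ∀ u f : Base → ℝ, ContDiff ℝ ∞ u → ContDiff ℝ ∞ f →
    ∀ z : Base, viscoOp ε γ u z = f z → prolongEquation ε γ V u f z = 0

/-! ### One-parameter groups of point transformations -/

/-- A smooth local one-parameter group of transformations of the `(x, y, t, u, f)`-space. -/
structure LocalOneParameterGroup where
  /-- the open set of pairs (parameter, point) for which the transformation is defined -/
  dom : Set (ℝ × Total)
  /-- the transformations -/
  map : ℝ → Total → Total
  isOpen_dom : IsOpen dom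
  zero_mem : ∀ p, (0, p) ∈ dom
  smooth : ContDiffOn ℝ ∞ (fun q : ℝ × Total => map q.1 q.2) dom
  map_zero : ∀ p, map 0 p = p
  map_add : ∀ r s p, (r, p) ∈ dom → (s, map r p) ∈ dom → (s + r, p) ∈ dom →
    map s (map r p) = map (s + r) p
  neg_mem : ∀ s p, (s, p) ∈ dom → (-s, map s p) ∈ dom

/-- The infinitesimal generator, `V(p) = d/ds Φ_s(p)` at `s = 0`. -/
noncomputable def LocalOneParameterGroup.generator (Φ : LocalOneParameterGroup) : Total → Total :=
  fun p => deriv (fun s => Φ.map s p) 0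

/-- `Φ` is a group of point symmetries: whenever some `Φ_s` carries the graph of a solution onto
the graph of a pair of smooth functions, the latter is again a solution. -/
def LocalOneParameterGroup.IsSymmetryGroup (Φ : LocalOneParameterGroup) (ε γ : ℝ) : Prop :=
  ∀ (s : ℝ) (Ω Ω' : Set Base) (u f u' f' : Base → ℝ), IsOpen Ω → IsOpen Ω' →
    IsSolutionOn ε γ u f Ω → (∀ z ∈ Ω, (s, ((z, u z, f z) : Total)) ∈ Φ.dom) →
    ContDiffOn ℝ ∞ u' Ω' → ContDiffOn ℝ ∞ f' Ω' →
    Φ.map s '' graphOver u f Ω = graphOver u' f' Ω' →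
    IsSolutionOn ε γ u' f' Ω'

/-! ### The generators -/

/-- `X₁ = ∂_x` -/
def X₁ : Total → Total := fun _ => (![1, 0, 0], 0, 0)

/-- `X₂ = ∂_y` -/
def X₂ : Total → Total := fun _ => (![0, 1, 0], 0, 0)

/-- `X₃ = ∂_t` -/
def X₃ : Total → Total := fun _ => (![0, 0, 1], 0, 0)

/-- `X₄ = y ∂_x - x ∂_y` -/
def X₄ : Total → Total := fun p => (![p.1 1, -p.1 0, 0], 0, 0)

/-- `X₅ = u ∂_u + f ∂_f` -/
def X₅ : Total → Total := fun p => (0, p.2.1, p.2.2)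

/-- The five generators as a family. -/
def X : Fin 5 → Total → Total := ![X₁, X₂, X₃, X₄, X₅]

/-- The vector field `α ∂_u + β ∂_f`, for functions `α, β` of `(x, y, t)`. -/
def verticalField (α β : Base → ℝ) : Total → Total := fun p => (0, α p.1, β p.1)

/-- The vector field `X_α = α ∂_u + (α_tt - ε ∂_t (Δ α) - γ Δ α) ∂_f`; it is `α ∂_u` when `α`
solves the homogeneous equation. -/
noncomputable def Xα (ε γ : ℝ) (α : Base → ℝ) : Total → Total :=
  verticalField α (viscoOp ε γ α)

/-- The commutator table of `X₁, …, X₅`. -/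
def commutatorTable : Matrix (Fin 5) (Fin 5) (Total → Total) :=
  !![0,   0,   0, -X₂, 0;
     0,   0,   0,  X₁, 0;
     0,   0,   0,  0,  0;
     X₂, -X₁,  0,  0,  0;
     0,   0,   0,  0,  0]

end Viscoelastic

open Viscoelastic

/-! Let `L` be the operator of the equation. Along a solution `(u, L u)`, invariance says that the
characteristic `(Q, R)` of `V` satisfies `L Q = R`. Linearising this at `u` in the direction
`exp (θ · z)` and dividing by the exponential gives an identity between polynomials in `θ`. Its
coefficients are the determining equations for the coefficients of `V` along `u`: the base part of
`V` is an infinitesimal Euclidean motion of the plane plus a translation in time (a homothety is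
excluded by `γ ≠ 0`), and `∂φ₁/∂u` is constant. Since the values of `u` and `L u` at two points can
be prescribed arbitrarily, none of these coefficients depends on `u` or `f`.

For a group of point symmetries, the transformed functions satisfy `L u_s = f_s`, and
`(∂_s u_s, ∂_s f_s)` at `s = 0` is the characteristic of the generator, which therefore satisfies
the same condition. -/

namespace Viscoelastic

open Filter Topology

section SmoothFunctions

variable {E F : Type*} [NormedAddCommGroup E] [NormedSpace ℝ E]
  [NormedAddCommGroup F] [NormedSpace ℝ F]

lemma contDiff_fderiv_apply {g : E → F} (hg : ContDiff ℝ ∞ g) (v : E) :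
    ContDiff ℝ ∞ (fun x => fderiv ℝ g x v) :=
  (hg.fderiv_right (m := ∞) (by simp)).clm_apply contDiff_const

lemma fderiv_fderiv_apply_comm {g : E → F} (hg : ContDiff ℝ 2 g) (v w x : E) :
    fderiv ℝ (fun y => fderiv ℝ g y v) x w = fderiv ℝ (fun y => fderiv ℝ g y w) x v := by
  have hd : DifferentiableAt ℝ (fderiv ℝ g) x :=
    (hg.fderiv_right (m := 1) (by norm_num)).differentiable (by simp) x
  have hs : IsSymmSndFDerivAt ℝ g x := hg.contDiffAt.isSymmSndFDerivAt (by simp)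
  rw [fderiv_clm_apply hd (differentiableAt_const v),
    fderiv_clm_apply hd (differentiableAt_const w)]
  simpa using hs.eq w v

lemma exists_contDiff_eventuallyEq [HasContDiffBump E] {g : E → F} {U : Set E}
    (hU : IsOpen U) (hg : ContDiffOn ℝ ∞ g U) {x : E} (hx : x ∈ U) :
    ∃ g' : E → F, ContDiff ℝ ∞ g' ∧ g' =ᶠ[𝓝 x] g := by
  obtain ⟨r, hr, hrU⟩ := Metric.isOpen_iff.1 hU x hx
  let b : ContDiffBump x := ⟨r / 4, r / 2, by positivity, by linarith⟩
  refine ⟨fun y => b y • g y, contDiff_iff_contDiffAt.2 fun y => ?_, ?_⟩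
  · by_cases hy : y ∈ U
    · exact b.contDiff.contDiffAt.smul (hg.contDiffAt (hU.mem_nhds hy))
    · have hball : y ∉ Metric.closedBall x (r / 2) := fun h =>
        hy (hrU (Metric.closedBall_subset_ball (by linarith) h))
      refine contDiffAt_const (c := (0 : F)) |>.congr_of_eventuallyEq ?_
      filter_upwards [Metric.isClosed_closedBall.isOpen_compl.mem_nhds hball] with w
        (hw : ¬ dist w x ≤ r / 2)
      have hbw : b w = 0 := b.zero_of_le_dist (not_le.1 hw).le
      rw [hbw, zero_smul]
  · filter_upwards [b.eventuallyEq_one] with y hy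
    simp [hy]

end SmoothFunctions

/-! ### Partial derivatives -/

section PartialDerivatives

variable {g h : Base → ℝ}

@[fun_prop]
lemma contDiff_pd (hg : ContDiff ℝ ∞ g) (i : Fin 3) : ContDiff ℝ ∞ (pd i g) :=
  contDiff_fderiv_apply hg _

lemma pd_congr {z : Base} (hgh : g =ᶠ[𝓝 z] h) (i : Fin 3) : pd i g =ᶠ[𝓝 z] pd i h := by
  filter_upwards [hgh.fderiv (𝕜 := ℝ)] with y hy
  simp [pd, hy]

lemma pd_comm (hg : ContDiff ℝ ∞ g) (i j : Fin 3) : pd i (pd j g) = pd j (pd i g) :=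
  funext fun _ => fderiv_fderiv_apply_comm (hg.of_le ENat.LEInfty.out) _ _ _

lemma pd_add (hg : ContDiff ℝ ∞ g) (hh : ContDiff ℝ ∞ h) (i : Fin 3) :
    pd i (fun z => g z + h z) = fun z => pd i g z + pd i h z := by
  funext z
  simp [pd, fderiv_fun_add (hg.differentiable (by simp) z) (hh.differentiable (by simp) z)]

lemma pd_sub (hg : ContDiff ℝ ∞ g) (hh : ContDiff ℝ ∞ h) (i : Fin 3) :
    pd i (fun z => g z - h z) = fun z => pd i g z - pd i h z := by
  funext z
  simp [pd, fderiv_fun_sub (hg.differentiable (by simp) z) (hh.differentiable (by simp) z)]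

lemma pd_mul (hg : ContDiff ℝ ∞ g) (hh : ContDiff ℝ ∞ h) (i : Fin 3) :
    pd i (fun z => g z * h z) = fun z => pd i g z * h z + g z * pd i h z := by
  funext z
  rw [pd, fderiv_fun_mul (hg.differentiable (by simp) z) (hh.differentiable (by simp) z)]
  simp [pd, mul_comm, add_comm]

lemma pd_const (c : ℝ) (i : Fin 3) : pd i (fun _ => c) = fun _ => 0 := by
  funext z
  simp [pd]

lemma pd_const_mul (hg : ContDiff ℝ ∞ g) (c : ℝ) (i : Fin 3) :
    pd i (fun z => c * g z) = fun z => c * pd i g z := by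
  simp [pd_mul contDiff_const hg, pd_const]

lemma pd_coord (i j : Fin 3) : pd i (fun z => z j) = fun _ => if i = j then 1 else 0 := by
  funext z
  simp [pd, fderiv_apply, Pi.single_apply, eq_comm]

lemma fderiv_eq_sum_pd (g : Base → ℝ) (z v : Base) : fderiv ℝ g z v = ∑ i, v i * pd i g z := by
  conv_lhs => rw [pi_eq_sum_univ' v, map_sum]
  simp [pd]

lemma eq_const_of_pd_eq_zero (hg : Differentiable ℝ g) (h : ∀ i z, pd i g z = 0) (z : Base) :
    g z = g 0 := by
  refine is_const_of_fderiv_eq_zero (𝕜 := ℝ) hg (fun z => ?_) z 0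
  ext1 v
  simp [fderiv_eq_sum_pd, h]

lemma eq_affine_of_pd_eq_const (hg : ContDiff ℝ ∞ g) (v : Base)
    (h : ∀ i z, pd i g z = v i) (z : Base) :
    g z = g 0 + (v 0 * z 0 + v 1 * z 1 + v 2 * z 2) := by
  have hsmooth : ContDiff ℝ ∞ fun z : Base => g z - (v 0 * z 0 + v 1 * z 1 + v 2 * z 2) := by
    fun_prop
  have hconst := eq_const_of_pd_eq_zero (hsmooth.differentiable (by simp)) (fun i z => by
    simp (disch := fun_prop) only [pd_add, pd_sub, pd_const_mul, pd_coord, h]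
    fin_cases i <;> simp) z
  simp only [Pi.zero_apply, mul_zero, add_zero, sub_zero] at hconst
  linarith

end PartialDerivatives

/-! ### The viscoelastic operator -/

section ViscoOp

variable {ε γ : ℝ} {g h : Base → ℝ}

@[fun_prop]
lemma contDiff_viscoOp (hg : ContDiff ℝ ∞ g) : ContDiff ℝ ∞ (viscoOp ε γ g) := by
  unfold viscoOp laplacian
  fun_prop

lemma viscoOp_congr {z : Base} (hgh : g =ᶠ[𝓝 z] h) : viscoOp ε γ g z = viscoOp ε γ h z := by
  have hΔ : laplacian g =ᶠ[𝓝 z] laplacian h :=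
    (pd_congr (pd_congr hgh 0) 0).add (pd_congr (pd_congr hgh 1) 1)
  simp only [viscoOp, (pd_congr (pd_congr hgh 2) 2).eq_of_nhds, (pd_congr hΔ 2).eq_of_nhds,
    hΔ.eq_of_nhds]

lemma viscoOp_eq (hg : ContDiff ℝ ∞ g) :
    viscoOp ε γ g = fun z => pd 2 (pd 2 g) z
      - ε * (pd 2 (pd 0 (pd 0 g)) z + pd 2 (pd 1 (pd 1 g)) z)
      - γ * (pd 0 (pd 0 g) z + pd 1 (pd 1 g) z) := by
  unfold viscoOp laplacian
  simp (disch := fun_prop) only [pd_add]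

lemma viscoOp_add (hg : ContDiff ℝ ∞ g) (hh : ContDiff ℝ ∞ h) :
    viscoOp ε γ (fun z => g z + h z) = fun z => viscoOp ε γ g z + viscoOp ε γ h z := by
  rw [viscoOp_eq hg, viscoOp_eq hh, viscoOp_eq (hg.add hh)]
  simp (disch := fun_prop) only [pd_add]
  funext z
  ring

lemma viscoOp_const_mul (c : ℝ) (hg : ContDiff ℝ ∞ g) :
    viscoOp ε γ (fun z => c * g z) = fun z => c * viscoOp ε γ g z := by
  rw [viscoOp_eq hg, viscoOp_eq (contDiff_const.mul hg)]
  simp (disch := fun_prop) only [pd_const_mul]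
  funext z
  ring

lemma viscoOp_sub (hg : ContDiff ℝ ∞ g) (hh : ContDiff ℝ ∞ h) :
    viscoOp ε γ (fun z => g z - h z) = fun z => viscoOp ε γ g z - viscoOp ε γ h z := by
  rw [viscoOp_eq hg, viscoOp_eq hh, viscoOp_eq (hg.sub hh)]
  simp (disch := fun_prop) only [pd_sub]
  funext z
  ring

lemma viscoOp_const (c : ℝ) : viscoOp ε γ (fun _ => c) = fun _ => 0 := by
  rw [viscoOp_eq contDiff_const]
  simp [pd_const]

end ViscoOp

/-! ### Dependence on a parameter -/

section Parameter

/-- The derivative of `g (s, z)` with respect to the parameter `s`. -/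
noncomputable def paramDeriv (g : ℝ × Base → ℝ) : ℝ × Base → ℝ :=
  fun q => fderiv ℝ g q (1, 0)

/-- The partial derivative of `g (s, z)` with respect to the `i`-th coordinate of `z`. -/
noncomputable def paramPd (i : Fin 3) (g : ℝ × Base → ℝ) : ℝ × Base → ℝ :=
  fun q => fderiv ℝ g q (0, Pi.single i 1)

variable {g : ℝ × Base → ℝ}

lemma fderiv_slice (hg : Differentiable ℝ g) (s : ℝ) (z v : Base) :
    fderiv ℝ (fun w => g (s, w)) z v = fderiv ℝ g (s, z) (0, v) := by
  have h : HasFDerivAt (fun w => g (s, w)) _ z :=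
    (hg (s, z)).hasFDerivAt.comp z (hasFDerivAt_prodMk_right s z)
  simp [h.fderiv]

lemma hasDerivAt_slice (hg : Differentiable ℝ g) (s : ℝ) (z : Base) :
    HasDerivAt (fun r => g (r, z)) (paramDeriv g (s, z)) s :=
  (hg (s, z)).hasFDerivAt.comp_hasDerivAt s ((hasDerivAt_id s).prodMk (hasDerivAt_const s z))

lemma pd_slice (hg : Differentiable ℝ g) (i : Fin 3) (s : ℝ) :
    pd i (fun z => g (s, z)) = fun z => paramPd i g (s, z) :=
  funext fun _ => fderiv_slice hg _ _ _

@[fun_prop]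
lemma contDiff_paramDeriv (hg : ContDiff ℝ ∞ g) : ContDiff ℝ ∞ (paramDeriv g) :=
  contDiff_fderiv_apply hg _

lemma contDiff_paramPd (hg : ContDiff ℝ ∞ g) (i : Fin 3) : ContDiff ℝ ∞ (paramPd i g) :=
  contDiff_fderiv_apply hg _

lemma paramDeriv_paramPd (hg : ContDiff ℝ ∞ g) (i : Fin 3) :
    paramDeriv (paramPd i g) = paramPd i (paramDeriv g) :=
  funext fun _ => fderiv_fderiv_apply_comm (hg.of_le ENat.LEInfty.out) _ _ _

lemma exists_pds_slice (J : List (Fin 3)) (hg : ContDiff ℝ ∞ g) :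
    ∃ G : ℝ × Base → ℝ, ContDiff ℝ ∞ G ∧ ∀ s,
      pds J (fun z => g (s, z)) = (fun z => G (s, z)) ∧
      pds J (fun z => paramDeriv g (s, z)) = fun z => paramDeriv G (s, z) := by
  induction J with
  | nil => exact ⟨g, hg, fun _ => ⟨rfl, rfl⟩⟩
  | cons i J ih =>
    obtain ⟨G, hG, hJ⟩ := ih
    refine ⟨paramPd i G, contDiff_paramPd hG i, fun s => ⟨?_, ?_⟩⟩
    · rw [← pd_slice (hG.differentiable (by simp)), ← (hJ s).1]
      rfl
    · rw [paramDeriv_paramPd hG, ← pd_slice (contDiff_paramDeriv hG |>.differentiable (by simp)),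
        ← (hJ s).2]
      rfl

lemma hasDerivAt_pds_slice (J : List (Fin 3)) (hg : ContDiff ℝ ∞ g) (s : ℝ) (z : Base) :
    HasDerivAt (fun r => pds J (fun w => g (r, w)) z)
      (pds J (fun w => paramDeriv g (s, w)) z) s := by
  obtain ⟨G, hG, hJ⟩ := exists_pds_slice J hg
  simp only [fun r => (hJ r).1, (hJ s).2]
  exact hasDerivAt_slice (hG.differentiable (by simp)) s z

lemma hasDerivAt_viscoOp_slice {ε γ : ℝ} (hg : ContDiff ℝ ∞ g) {g' : Base → ℝ} {s : ℝ}
    (hg' : ∀ w, HasDerivAt (fun r => g (r, w)) (g' w) s) (z : Base) :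
    HasDerivAt (fun r => viscoOp ε γ (fun w => g (r, w)) z) (viscoOp ε γ g' z) s := by
  obtain rfl : g' = fun w => paramDeriv g (s, w) :=
    funext fun w => (hg' w).unique (hasDerivAt_slice (hg.differentiable (by simp)) s w)
  have hJ := fun J => hasDerivAt_pds_slice J hg s z
  have hslice : ∀ r, ContDiff ℝ ∞ fun w => g (r, w) := fun r => by fun_prop
  simp only [fun r => viscoOp_eq (ε := ε) (γ := γ) (hslice r)]
  rw [viscoOp_eq (by fun_prop)]
  exact ((hJ [2, 2]).sub (((hJ [2, 0, 0]).add (hJ [2, 1, 1])).const_mul ε)).sub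
    (((hJ [0, 0]).add (hJ [1, 1])).const_mul γ)

end Parameter

/-! ### The listed vector fields are infinitesimal symmetries -/

section InfinitesimalSymmetries

variable {ε γ : ℝ}

lemma contDiff_characteristicU {V : Total → Total} (hV : ContDiff ℝ ∞ V) {u f : Base → ℝ}
    (hu : ContDiff ℝ ∞ u) (hf : ContDiff ℝ ∞ f) : ContDiff ℝ ∞ (characteristicU V u f) := by
  unfold characteristicU
  fun_prop

lemma prolongEquation_eq {V : Total → Total} (hV : ContDiff ℝ ∞ V) {u f : Base → ℝ}
    (hu : ContDiff ℝ ∞ u) (hf : ContDiff ℝ ∞ f) (z : Base) :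
    prolongEquation ε γ V u f z = viscoOp ε γ (characteristicU V u f) z
      + ∑ i, (V (z, u z, f z)).1 i * pd i (viscoOp ε γ u) z - (V (z, u z, f z)).2.2 := by
  rw [viscoOp_eq (contDiff_characteristicU hV hu hf), viscoOp_eq hu]
  simp (disch := fun_prop) only [pd_sub, pd_add, pd_const_mul]
  simp only [prolongEquation, prolongU, pds, List.foldr, Fin.sum_univ_three]
  ring

/-- The infinitesimal generator of a one-parameter group composed of Euclidean motions of the
`(x, y)`-plane and translations in `t`. -/
def motionField (a b c d : ℝ) (z : Base) : Base := ![a + d * z 1, b - d * z 0, c]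

lemma contDiff_motionField (a b c d : ℝ) : ContDiff ℝ ∞ (motionField a b c d) := by
  refine contDiff_pi.2 fun i => ?_
  fin_cases i <;> simp only [motionField, Fin.zero_eta, Fin.mk_one, Fin.reduceFinMk,
    Matrix.cons_val] <;> fun_prop

lemma viscoOp_sum_motionField_mul_pd (a b c d : ℝ) {u : Base → ℝ} (hu : ContDiff ℝ ∞ u) (z : Base) :
    viscoOp ε γ (fun w => ∑ i, motionField a b c d w i * pd i u w) z
      = ∑ i, motionField a b c d z i * pd i (viscoOp ε γ u) z := by
  simp only [Fin.sum_univ_three, motionField, Matrix.cons_val]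
  rw [viscoOp_eq (by fun_prop), viscoOp_eq hu]
  simp (disch := fun_prop) only [pd_sub, pd_add, pd_const_mul, pd_mul, pd_const, pd_coord]
  simp (disch := fun_prop) only [pd_comm _ 2, pd_comm _ 1 0]
  simp only [Fin.isValue, Fin.reduceEq, ↓reduceIte, mul_zero, add_zero, zero_mul, zero_add,
    sub_self, zero_ne_one, one_ne_zero, mul_one, zero_sub, neg_mul]
  ring

lemma sum_X_add_Xα_apply (c : Fin 5 → ℝ) (α : Base → ℝ) (p : Total) :
    (∑ i, c i • X i + Xα ε γ α) p =
      (motionField (c 0) (c 1) (c 2) (c 3) p.1, c 4 * p.2.1 + α p.1,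
        c 4 * p.2.2 + viscoOp ε γ α p.1) := by
  refine Prod.ext (funext fun i => ?_) (Prod.ext ?_ ?_)
  case refine_2 => simp [Fin.sum_univ_five, X, X₁, X₂, X₃, X₄, X₅, Xα, verticalField]
  case refine_3 => simp [Fin.sum_univ_five, X, X₁, X₂, X₃, X₄, X₅, Xα, verticalField]
  fin_cases i <;>
    simp [Fin.sum_univ_five, X, X₁, X₂, X₃, X₄, X₅, Xα, verticalField, motionField, sub_eq_add_neg]

theorem isInfinitesimalSymmetry_sum_X_add_Xα (c : Fin 5 → ℝ) {α : Base → ℝ}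
    (hα : ContDiff ℝ ∞ α) : IsInfinitesimalSymmetry ε γ (∑ i, c i • X i + Xα ε γ α) := by
  intro u f hu hf z huf
  have hξ := contDiff_motionField (c 0) (c 1) (c 2) (c 3)
  have hV : ContDiff ℝ ∞ (∑ i, c i • X i + Xα ε γ α) := by
    rw [funext (sum_X_add_Xα_apply c α)]
    fun_prop
  have hQ : characteristicU (∑ i, c i • X i + Xα ε γ α) u f = fun w => c 4 * u w + α w
      - ∑ i, motionField (c 0) (c 1) (c 2) (c 3) w i * pd i u w := by
    funext w
    simp only [characteristicU, sum_X_add_Xα_apply]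
  rw [prolongEquation_eq hV hu hf, hQ, viscoOp_sub (by fun_prop) (by fun_prop),
    viscoOp_add (by fun_prop) hα, viscoOp_const_mul _ hu]
  simp only [viscoOp_sum_motionField_mul_pd _ _ _ _ hu, sum_X_add_Xα_apply, huf]
  ring

theorem isInfinitesimalSymmetry_verticalField_iff {α β : Base → ℝ} (hα : ContDiff ℝ ∞ α)
    (hβ : ContDiff ℝ ∞ β) :
    IsInfinitesimalSymmetry ε γ (verticalField α β) ↔ ∀ z, viscoOp ε γ α z = β z := by
  have hV : ContDiff ℝ ∞ (verticalField α β) := by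
    unfold verticalField
    fun_prop
  have hQ : ∀ u f, characteristicU (verticalField α β) u f = α := fun u f => by
    funext z
    simp [characteristicU, verticalField]
  have hprolong : ∀ u f, ContDiff ℝ ∞ u → ContDiff ℝ ∞ f → ∀ z,
      prolongEquation ε γ (verticalField α β) u f z = viscoOp ε γ α z - β z := by
    intro u f hu hf z
    simp [prolongEquation_eq hV hu hf, hQ, verticalField]
  refine ⟨fun h z => ?_, fun h u f hu hf z _ => by rw [hprolong u f hu hf, h, sub_self]⟩
  have hzero := h _ _ contDiff_const contDiff_const z (congrFun (viscoOp_const 0) z)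
  exact sub_eq_zero.1 ((hprolong _ _ contDiff_const contDiff_const z).symm.trans hzero)

end InfinitesimalSymmetries

/-! ### Linearisation of the invariance condition -/

section Linearisation

variable {ε γ : ℝ} {V : Total → Total} {u f η φ : Base → ℝ}

/-- The `f`-component `φ₂ - ∑ᵢ ξⁱ fᵢ` of the characteristic of the vector field `V`, along the pair
of functions `(u, f)`; the counterpart of `characteristicU`. -/
noncomputable def characteristicF (V : Total → Total) (u f : Base → ℝ) : Base → ℝ :=
  fun z => (V (z, u z, f z)).2.2 - ∑ i, (V (z, u z, f z)).1 i * pd i f z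

/-- The invariance condition along global solutions: the characteristic of `V` along `(u, L u)`
solves the equation. -/
def IsInvariantOnSolutions (ε γ : ℝ) (V : Total → Total) : Prop :=
  ∀ u : Base → ℝ, ContDiff ℝ ∞ u →
    viscoOp ε γ (characteristicU V u (viscoOp ε γ u)) = characteristicF V u (viscoOp ε γ u)

lemma IsInfinitesimalSymmetry.isInvariantOnSolutions (hV : ContDiff ℝ ∞ V)
    (h : IsInfinitesimalSymmetry ε γ V) : IsInvariantOnSolutions ε γ V := fun u hu => by
  funext z
  have hz := h u _ hu (contDiff_viscoOp hu) z rfl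
  rw [prolongEquation_eq hV hu (contDiff_viscoOp hu)] at hz
  simp only [characteristicF]
  linear_combination hz

/-- The derivative of a function on the total space in the direction of `u`. -/
noncomputable def derivU {F : Type*} [NormedAddCommGroup F] [NormedSpace ℝ F] (g : Total → F) :
    Total → F :=
  fun p => fderiv ℝ g p (0, 1, 0)

/-- The derivative of a function on the total space in the direction of `f`. -/
noncomputable def derivF {F : Type*} [NormedAddCommGroup F] [NormedSpace ℝ F] (g : Total → F) :
    Total → F :=
  fun p => fderiv ℝ g p (0, 0, 1)

section

variable {F : Type*} [NormedAddCommGroup F] [NormedSpace ℝ F] {g : Total → F}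

@[fun_prop]
lemma contDiff_derivU (hg : ContDiff ℝ ∞ g) : ContDiff ℝ ∞ (derivU g) :=
  contDiff_fderiv_apply hg _

@[fun_prop]
lemma contDiff_derivF (hg : ContDiff ℝ ∞ g) : ContDiff ℝ ∞ (derivF g) :=
  contDiff_fderiv_apply hg _

lemma hasDerivAt_comp_perturbation (hg : Differentiable ℝ g) (z : Base) (a b c d s : ℝ) :
    HasDerivAt (fun s : ℝ => g (z, a + s * c, b + s * d))
      (c • derivU g (z, a + s * c, b + s * d) + d • derivF g (z, a + s * c, b + s * d)) s := by
  have hline : HasDerivAt (fun s : ℝ => ((z, a + s * c, b + s * d) : Total)) (0, c, d) s := by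
    simpa using (hasDerivAt_const s z).prodMk
      ((((hasDerivAt_id s).mul_const c).const_add a).prodMk
        (((hasDerivAt_id s).mul_const d).const_add b))
  have hsplit : ((0, c, d) : Total) = c • (0, 1, 0) + d • (0, 0, 1) := by simp
  have hcomp := ((hg _).hasFDerivAt).comp_hasDerivAt s hline
  rwa [hsplit, map_add, map_smul, map_smul] at hcomp

end

lemma hasDerivAt_comp_perturbation_sub_sum {k : Total → ℝ} {ξ : Total → Base}
    (hk : Differentiable ℝ k) (hξ : Differentiable ℝ ξ) (z : Base) (a b c d : ℝ) (v w : Base) :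
    HasDerivAt
      (fun s : ℝ => k (z, a + s * c, b + s * d)
        - ∑ i, ξ (z, a + s * c, b + s * d) i * (v i + s * w i))
      ((derivU k (z, a, b) - ∑ i, derivU ξ (z, a, b) i * v i) * c
        + (derivF k (z, a, b) - ∑ i, derivF ξ (z, a, b) i * v i) * d
        - ∑ i, ξ (z, a, b) i * w i) 0 := by
  have hterm : ∀ i, HasDerivAt (fun s : ℝ => ξ (z, a + s * c, b + s * d) i * (v i + s * w i))
      ((c * derivU ξ (z, a, b) i + d * derivF ξ (z, a, b) i) * v i + ξ (z, a, b) i * w i) 0 := by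
    intro i
    simpa using (hasDerivAt_pi.1 (hasDerivAt_comp_perturbation hξ z a b c d 0) i).fun_mul
      (((hasDerivAt_id (0 : ℝ)).mul_const (w i)).const_add (v i))
  refine ((hasDerivAt_comp_perturbation hk z a b c d 0).fun_sub
    (HasDerivAt.fun_sum fun i _ => hterm i)).congr_deriv ?_
  simp only [Fin.sum_univ_three, smul_eq_mul, zero_mul, add_zero]
  ring

lemma hasDerivAt_characteristicU_perturbation (hV : ContDiff ℝ ∞ V) (hu : ContDiff ℝ ∞ u)
    (hη : ContDiff ℝ ∞ η) (z : Base) :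
    HasDerivAt
      (fun s : ℝ => characteristicU V (fun w => u w + s * η w) (fun w => f w + s * φ w) z)
      (characteristicU (derivU V) u f z * η z + characteristicU (derivF V) u f z * φ z
        - ∑ i, (V (z, u z, f z)).1 i * pd i η z) 0 := by
  have hVd := hV.differentiable (by simp)
  simp (disch := fun_prop) only [characteristicU, pd_add, pd_const_mul]
  convert hasDerivAt_comp_perturbation_sub_sum hVd.snd.fst hVd.fst z (u z) (f z) (η z) (φ z)
    (fun i => pd i u z) (fun i => pd i η z) using 1
  simp [derivU, derivF, fderiv.fst, fderiv.snd, hVd.snd _, hVd _]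

lemma hasDerivAt_characteristicF_perturbation (hV : ContDiff ℝ ∞ V) (hf : ContDiff ℝ ∞ f)
    (hφ : ContDiff ℝ ∞ φ) (z : Base) :
    HasDerivAt
      (fun s : ℝ => characteristicF V (fun w => u w + s * η w) (fun w => f w + s * φ w) z)
      (characteristicF (derivU V) u f z * η z + characteristicF (derivF V) u f z * φ z
        - ∑ i, (V (z, u z, f z)).1 i * pd i φ z) 0 := by
  have hVd := hV.differentiable (by simp)
  simp (disch := fun_prop) only [characteristicF, pd_add, pd_const_mul]
  convert hasDerivAt_comp_perturbation_sub_sum hVd.snd.snd hVd.fst z (u z) (f z) (η z) (φ z)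
    (fun i => pd i f z) (fun i => pd i φ z) using 1
  simp [derivU, derivF, fderiv.fst, fderiv.snd, hVd.snd _, hVd _]

lemma contDiff_characteristicU_perturbation (hV : ContDiff ℝ ∞ V) (hu : ContDiff ℝ ∞ u)
    (hf : ContDiff ℝ ∞ f) (hη : ContDiff ℝ ∞ η) (hφ : ContDiff ℝ ∞ φ) :
    ContDiff ℝ ∞ fun q : ℝ × Base =>
      characteristicU V (fun w => u w + q.1 * η w) (fun w => f w + q.1 * φ w) q.2 := by
  simp (disch := fun_prop) only [characteristicU, pd_add, pd_const_mul]
  fun_prop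

lemma IsInvariantOnSolutions.linearised (h : IsInvariantOnSolutions ε γ V) (hV : ContDiff ℝ ∞ V)
    (hu : ContDiff ℝ ∞ u) (hf : f = viscoOp ε γ u) (hη : ContDiff ℝ ∞ η)
    (hφ : φ = viscoOp ε γ η) (z : Base) :
    viscoOp ε γ (fun w => characteristicU (derivU V) u f w * η w
        + characteristicU (derivF V) u f w * φ w - ∑ i, (V (w, u w, f w)).1 i * pd i η w) z
      = characteristicF (derivU V) u f z * η z + characteristicF (derivF V) u f z * φ z
        - ∑ i, (V (z, u z, f z)).1 i * pd i φ z := by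
  have hfs : ContDiff ℝ ∞ f := hf ▸ contDiff_viscoOp hu
  have hφs : ContDiff ℝ ∞ φ := hφ ▸ contDiff_viscoOp hη
  have hinv : ∀ s : ℝ,
      viscoOp ε γ (characteristicU V (fun w => u w + s * η w) (fun w => f w + s * φ w)) z
        = characteristicF V (fun w => u w + s * η w) (fun w => f w + s * φ w) z := by
    intro s
    have hL : viscoOp ε γ (fun w => u w + s * η w) = fun w => f w + s * φ w := by
      rw [viscoOp_add hu (by fun_prop), viscoOp_const_mul s hη, hf, hφ]
    rw [← hL, h _ (by fun_prop)]
  have hleft := hasDerivAt_viscoOp_slice (ε := ε) (γ := γ)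
    (contDiff_characteristicU_perturbation hV hu hfs hη hφs)
    (hasDerivAt_characteristicU_perturbation hV hu hη) z
  exact (hleft.congr_of_eventuallyEq (.of_forall fun s => (hinv s).symm)).unique
    (hasDerivAt_characteristicF_perturbation hV hfs hφs z)

end Linearisation

/-! ### Exponential perturbations and the determining equations -/

section Exponentials

variable {ε γ : ℝ} {a : Base → ℝ}

/-- The exponential `exp (θ · z)`. -/
noncomputable def expWave (θ z : Base) : ℝ := Real.exp (∑ i, θ i * z i)

@[fun_prop]
lemma contDiff_expWave (θ : Base) : ContDiff ℝ ∞ (expWave θ) := by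
  unfold expWave
  fun_prop

lemma expWave_ne_zero (θ z : Base) : expWave θ z ≠ 0 := (Real.exp_pos _).ne'

lemma pd_expWave (θ : Base) (i : Fin 3) : pd i (expWave θ) = fun z => θ i * expWave θ z := by
  funext z
  have hsum : HasFDerivAt (fun z : Base => ∑ j, θ j * z j)
      (∑ j, θ j • ContinuousLinearMap.proj (R := ℝ) (φ := fun _ : Fin 3 => ℝ) j) z :=
    HasFDerivAt.fun_sum fun j _ => (hasFDerivAt_apply j z).const_mul (θ j)
  have hexp : HasFDerivAt (expWave θ) _ z := hsum.exp
  rw [pd, hexp.fderiv]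
  simp [expWave, Pi.single_apply, mul_comm]

/-- The conjugate `exp (-θ · z) ∂ᵢ (exp (θ · z) a)` of a partial derivative. -/
noncomputable def conjPd (θ : Base) (i : Fin 3) (a : Base → ℝ) : Base → ℝ :=
  fun z => pd i a z + θ i * a z

/-- The conjugate `exp (-θ · z) L (exp (θ · z) a)` of the viscoelastic operator. -/
noncomputable def conjViscoOp (ε γ : ℝ) (θ : Base) (a : Base → ℝ) : Base → ℝ :=
  fun z => conjPd θ 2 (conjPd θ 2 a) z
    - ε * (conjPd θ 2 (conjPd θ 0 (conjPd θ 0 a)) z + conjPd θ 2 (conjPd θ 1 (conjPd θ 1 a)) z)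
    - γ * (conjPd θ 0 (conjPd θ 0 a) z + conjPd θ 1 (conjPd θ 1 a) z)

/-- The symbol of the viscoelastic operator. -/
def viscoSymbol (ε γ : ℝ) (θ : Base) : ℝ :=
  θ 2 ^ 2 - ε * (θ 2 * (θ 0 ^ 2 + θ 1 ^ 2)) - γ * (θ 0 ^ 2 + θ 1 ^ 2)

@[fun_prop]
lemma contDiff_conjPd (ha : ContDiff ℝ ∞ a) (θ : Base) (i : Fin 3) :
    ContDiff ℝ ∞ (conjPd θ i a) := by
  unfold conjPd
  fun_prop

lemma pd_mul_expWave (ha : ContDiff ℝ ∞ a) (θ : Base) (i : Fin 3) :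
    pd i (fun z => a z * expWave θ z) = fun z => conjPd θ i a z * expWave θ z := by
  rw [pd_mul ha (contDiff_expWave θ), pd_expWave]
  funext z
  simp only [conjPd]
  ring

lemma viscoOp_mul_expWave (ha : ContDiff ℝ ∞ a) (θ : Base) :
    viscoOp ε γ (fun z => a z * expWave θ z) = fun z => conjViscoOp ε γ θ a z * expWave θ z := by
  rw [viscoOp_eq (by fun_prop)]
  simp (disch := fun_prop) only [pd_mul_expWave]
  funext z
  simp only [conjViscoOp]
  ring

lemma viscoOp_expWave (θ : Base) :
    viscoOp ε γ (expWave θ) = fun z => viscoSymbol ε γ θ * expWave θ z := by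
  rw [viscoOp_eq (by fun_prop)]
  simp (disch := fun_prop) only [pd_expWave, pd_const_mul]
  funext z
  simp only [viscoSymbol]
  ring

lemma conjViscoOp_eq (ha : ContDiff ℝ ∞ a) (θ : Base) :
    conjViscoOp ε γ θ a = fun z =>
      pd 2 (pd 2 a) z + 2 * θ 2 * pd 2 a z + θ 2 ^ 2 * a z
      - ε * (pd 2 (pd 0 (pd 0 a)) z + 2 * θ 0 * pd 2 (pd 0 a) z + θ 0 ^ 2 * pd 2 a z
        + θ 2 * pd 0 (pd 0 a) z + 2 * θ 2 * θ 0 * pd 0 a z + θ 2 * θ 0 ^ 2 * a z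
        + (pd 2 (pd 1 (pd 1 a)) z + 2 * θ 1 * pd 2 (pd 1 a) z + θ 1 ^ 2 * pd 2 a z
        + θ 2 * pd 1 (pd 1 a) z + 2 * θ 2 * θ 1 * pd 1 a z + θ 2 * θ 1 ^ 2 * a z))
      - γ * (pd 0 (pd 0 a) z + 2 * θ 0 * pd 0 a z + θ 0 ^ 2 * a z
        + (pd 1 (pd 1 a) z + 2 * θ 1 * pd 1 a z + θ 1 ^ 2 * a z)) := by
  unfold conjViscoOp conjPd
  simp (disch := fun_prop) only [pd_add, pd_const_mul]
  funext z
  ring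

lemma conjViscoOp_zero (θ : Base) : conjViscoOp ε γ θ 0 = 0 := by
  have hzero : ∀ i, conjPd θ i 0 = 0 := fun i => by
    funext z
    simp [conjPd, pd]
  funext z
  simp [conjViscoOp, hzero]

lemma conjViscoOp_sub_sum {A B : Base → ℝ} {ξ : Base → Base} (hA : ContDiff ℝ ∞ A)
    (hB : ContDiff ℝ ∞ B) (hξ : ContDiff ℝ ∞ ξ) (c : ℝ) (θ z : Base) :
    conjViscoOp ε γ θ (fun w => A w + c * B w - ∑ i, θ i * ξ w i) z =
      conjViscoOp ε γ θ A z + c * conjViscoOp ε γ θ B z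
        - ∑ i, θ i * conjViscoOp ε γ θ (fun w => ξ w i) z := by
  simp (disch := fun_prop) only [Fin.sum_univ_three, conjViscoOp_eq, pd_add, pd_sub, pd_const_mul]
  ring

end Exponentials

section DeterminingEquations

variable {ε γ : ℝ} {V : Total → Total}

/-- The polynomial in `θ` whose vanishing at `z` is the invariance condition linearised in the
direction `exp (θ · z)`, for coefficient functions `A`, `B`, `ξ` and numbers `A'`, `B'`. -/
noncomputable def linearisedSymbol (ε γ : ℝ) (A B : Base → ℝ) (ξ : Base → Base) (A' B' : ℝ)
    (z θ : Base) : ℝ :=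
  conjViscoOp ε γ θ A z + viscoSymbol ε γ θ * conjViscoOp ε γ θ B z
    - ∑ i, θ i * conjViscoOp ε γ θ (fun w => ξ w i) z
    - (A' + viscoSymbol ε γ θ * (B' - ∑ i, θ i * ξ z i))

lemma IsInvariantOnSolutions.linearisedSymbol_eq_zero (h : IsInvariantOnSolutions ε γ V)
    (hV : ContDiff ℝ ∞ V) {u f : Base → ℝ} (hu : ContDiff ℝ ∞ u) (hf : f = viscoOp ε γ u)
    (z θ : Base) :
    linearisedSymbol ε γ (characteristicU (derivU V) u f) (characteristicU (derivF V) u f)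
      (fun w => (V (w, u w, f w)).1) (characteristicF (derivU V) u f z)
      (characteristicF (derivF V) u f z) z θ = 0 := by
  have hfs : ContDiff ℝ ∞ f := hf ▸ contDiff_viscoOp hu
  have hA := contDiff_characteristicU (contDiff_derivU hV) hu hfs
  have hB := contDiff_characteristicU (contDiff_derivF hV) hu hfs
  have hlin := h.linearised hV hu hf (contDiff_expWave θ) (viscoOp_expWave θ).symm z
  have hamp : (fun w => characteristicU (derivU V) u f w * expWave θ w
      + characteristicU (derivF V) u f w * (viscoSymbol ε γ θ * expWave θ w)
      - ∑ i, (V (w, u w, f w)).1 i * pd i (expWave θ) w) =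
      fun w => (characteristicU (derivU V) u f w
        + viscoSymbol ε γ θ * characteristicU (derivF V) u f w
        - ∑ i, θ i * (V (w, u w, f w)).1 i) * expWave θ w := by
    funext w
    simp only [pd_expWave, Fin.sum_univ_three]
    ring
  rw [hamp, viscoOp_mul_expWave (by fun_prop)] at hlin
  simp (disch := fun_prop) only [pd_const_mul, pd_expWave] at hlin
  refine (mul_eq_zero_iff_right (expWave_ne_zero θ z)).1 ?_
  rw [linearisedSymbol, ← conjViscoOp_sub_sum hA hB (by fun_prop)]
  simp only [Fin.sum_univ_three] at hlin ⊢
  linear_combination hlin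

variable {A B : Base → ℝ} {ξ : Base → Base} {A' B' : ℝ} {z : Base}

lemma eq_zero_of_linearisedSymbol_eq_zero (hε : ε ≠ 0) (hA : ContDiff ℝ ∞ A)
    (hB : ContDiff ℝ ∞ B) (hξ : ContDiff ℝ ∞ ξ)
    (h : ∀ θ, linearisedSymbol ε γ A B ξ A' B' z θ = 0) : B z = 0 := by
  -- Along `θ = (a, 0, a)` the only term of degree six is `ε² a⁶ B`; the sixth finite difference
  -- isolates it.
  have hθ := fun a : ℝ => h ![a, 0, a]
  simp (disch := fun_prop) only [linearisedSymbol, conjViscoOp_eq, viscoSymbol, Fin.sum_univ_three,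
    Matrix.cons_val] at hθ
  have h720 : 720 * ε ^ 2 * B z = 0 := by
    linear_combination hθ 3 - 6 * hθ 2 + 15 * hθ 1 - 20 * hθ 0 + 15 * hθ (-1) - 6 * hθ (-2)
      + hθ (-3)
  simpa [hε] using h720

/-- The equations at `z` for the coefficients `A`, `ξ` given by the part of degree at least three of
`linearisedSymbol` with `B = 0`. They say that `ξ` splits into a conformal field of the plane and a
field along the time axis; `pd_i_j` governs `∂ᵢ ξʲ`. -/
structure PrincipalDeterminingEquations (A : Base → ℝ) (ξ : Base → Base) (B' : ℝ) (z : Base) :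
    Prop where
  pd_two_zero : pd 2 (fun w => ξ w 0) z = 0
  pd_two_one : pd 2 (fun w => ξ w 1) z = 0
  pd_zero_two : pd 0 (fun w => ξ w 2) z = 0
  pd_one_two : pd 1 (fun w => ξ w 2) z = 0
  pd_one_zero : pd 1 (fun w => ξ w 0) z = -pd 0 (fun w => ξ w 1) z
  pd_zero_zero : 2 * pd 0 (fun w => ξ w 0) z = A z - B' - pd 2 (fun w => ξ w 2) z
  pd_one_one : 2 * pd 1 (fun w => ξ w 1) z = A z - B' - pd 2 (fun w => ξ w 2) z

/-- The equations at `z` for the coefficients `A`, `ξ` that express the vanishing of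
`linearisedSymbol` with `B = 0`; `pd_i_coeff` governs `∂ᵢ A`. -/
structure DeterminingEquations (ε γ : ℝ) (A : Base → ℝ) (ξ : Base → Base) (B' : ℝ) (z : Base) :
    Prop extends PrincipalDeterminingEquations A ξ B' z where
  pd_two_two : 2 * pd 2 (fun w => ξ w 2) z = A z - B' + ε * laplacian (fun w => ξ w 2) z
  pd_zero_coeff : 2 * ε * pd 0 A z = ε * laplacian (fun w => ξ w 0) z
    - 2 * pd 2 (fun w => ξ w 0) z + 2 * ε * pd 2 (pd 0 fun w => ξ w 2) z
    + 2 * γ * pd 0 (fun w => ξ w 2) z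
  pd_one_coeff : 2 * ε * pd 1 A z = ε * laplacian (fun w => ξ w 1) z
    - 2 * pd 2 (fun w => ξ w 1) z + 2 * ε * pd 2 (pd 1 fun w => ξ w 2) z
    + 2 * γ * pd 1 (fun w => ξ w 2) z
  pd_two_coeff : 2 * pd 2 A z = ε * laplacian A z + viscoOp ε γ (fun w => ξ w 2) z
  constraint : ε * pd 2 A z + γ * (A z - B')
    = 2 * ε * pd 2 (pd 0 fun w => ξ w 0) z + 2 * γ * pd 0 (fun w => ξ w 0) z

lemma PrincipalDeterminingEquations.of_linearisedSymbol_eq_zero (hε : ε ≠ 0) (hA : ContDiff ℝ ∞ A)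
    (hξ : ContDiff ℝ ∞ ξ) (h : ∀ θ, linearisedSymbol ε γ A 0 ξ A' B' z θ = 0) :
    PrincipalDeterminingEquations A ξ B' z := by
  -- Each equation is the coefficient of one monomial in `θ`, isolated by finite differences.
  have hθ := fun a b c : ℝ => h ![a, b, c]
  simp (disch := fun_prop) only [linearisedSymbol, conjViscoOp_eq, viscoSymbol, Fin.sum_univ_three,
    Matrix.cons_val, conjViscoOp_zero, Pi.zero_apply] at hθ
  constructor
  case pd_two_zero => -- `θ₀³`
    refine mul_left_cancel₀ hε ?_
    linear_combination (hθ 2 0 0 - 2 * hθ 1 0 0 + 2 * hθ (-1) 0 0 - hθ (-2) 0 0) / 12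
  case pd_two_one => -- `θ₁³`
    refine mul_left_cancel₀ hε ?_
    linear_combination (hθ 0 2 0 - 2 * hθ 0 1 0 + 2 * hθ 0 (-1) 0 - hθ 0 (-2) 0) / 12
  case pd_zero_two => -- `θ₀ θ₂²`
    refine mul_left_cancel₀ hε ?_
    linear_combination (hθ 1 0 1 + hθ 1 0 (-1) - 2 * hθ 1 0 0
      - (hθ (-1) 0 1 + hθ (-1) 0 (-1) - 2 * hθ (-1) 0 0)) / 8
  case pd_one_two => -- `θ₁ θ₂²`
    refine mul_left_cancel₀ hε ?_
    linear_combination (hθ 0 1 1 + hθ 0 1 (-1) - 2 * hθ 0 1 0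
      - (hθ 0 (-1) 1 + hθ 0 (-1) (-1) - 2 * hθ 0 (-1) 0)) / 8
  case pd_one_zero => -- `θ₀ θ₁ θ₂`
    refine mul_left_cancel₀ hε ?_
    linear_combination (hθ 1 1 1 - hθ 1 1 (-1) - hθ 1 (-1) 1 + hθ 1 (-1) (-1)
      - (hθ (-1) 1 1 - hθ (-1) 1 (-1) - hθ (-1) (-1) 1 + hθ (-1) (-1) (-1))) / 16
  case pd_zero_zero => -- `θ₀² θ₂`
    refine mul_left_cancel₀ hε ?_
    linear_combination (hθ 1 0 1 + hθ (-1) 0 1 - 2 * hθ 0 0 1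
      - (hθ 1 0 (-1) + hθ (-1) 0 (-1) - 2 * hθ 0 0 (-1))) / 4
  case pd_one_one => -- `θ₁² θ₂`
    refine mul_left_cancel₀ hε ?_
    linear_combination (hθ 0 1 1 + hθ 0 (-1) 1 - 2 * hθ 0 0 1
      - (hθ 0 1 (-1) + hθ 0 (-1) (-1) - 2 * hθ 0 0 (-1))) / 4

lemma DeterminingEquations.of_linearisedSymbol_eq_zero (hε : ε ≠ 0) (hA : ContDiff ℝ ∞ A)
    (hξ : ContDiff ℝ ∞ ξ) (h : ∀ θ, linearisedSymbol ε γ A 0 ξ A' B' z θ = 0) :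
    DeterminingEquations ε γ A ξ B' z := by
  have hθ := fun a b c : ℝ => h ![a, b, c]
  simp (disch := fun_prop) only [linearisedSymbol, conjViscoOp_eq, viscoSymbol, Fin.sum_univ_three,
    Matrix.cons_val, conjViscoOp_zero, Pi.zero_apply] at hθ
  constructor
  case toPrincipalDeterminingEquations =>
    exact .of_linearisedSymbol_eq_zero hε hA hξ h
  case pd_two_two => -- `θ₂²`
    simp only [laplacian]
    linear_combination -(hθ 0 0 1 + hθ 0 0 (-1) - 2 * hθ 0 0 0) / 2
  case pd_zero_coeff => -- `θ₀ θ₂`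
    simp only [laplacian]
    linear_combination -(hθ 1 0 1 - hθ 1 0 (-1) - hθ (-1) 0 1 + hθ (-1) 0 (-1)) / 4
  case pd_one_coeff => -- `θ₁ θ₂`
    simp only [laplacian]
    linear_combination -(hθ 0 1 1 - hθ 0 1 (-1) - hθ 0 (-1) 1 + hθ 0 (-1) (-1)) / 4
  case pd_two_coeff => -- `θ₂`
    simp (disch := fun_prop) only [viscoOp_eq, laplacian]
    linear_combination (hθ 0 0 1 - hθ 0 0 (-1)) / 2
  case constraint => -- `θ₀²`
    linear_combination -(hθ 1 0 0 + hθ (-1) 0 0 - 2 * hθ 0 0 0) / 2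

end DeterminingEquations

/-! ### Solution of the determining equations -/

section DeterminingEquationsSolution

variable {ε γ : ℝ} {A B' : Base → ℝ} {ξ : Base → Base}

lemma laplacian_eq_zero_of_cauchyRiemann {g h : Base → ℝ} (hg : ContDiff ℝ ∞ g)
    (hh : ContDiff ℝ ∞ h) (h₀ : pd 0 g = pd 1 h) (h₁ : pd 1 g = fun z => -1 * pd 0 h z) :
    laplacian g = 0 ∧ laplacian h = 0 := by
  have h₁' : pd 0 h = fun z => -1 * pd 1 g z := by
    funext z
    simp [h₁]
  constructor <;> funext z
  · simp only [laplacian, h₀, h₁, pd_const_mul (contDiff_pd hh 0), pd_comm hh 0 1, Pi.zero_apply]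
    ring
  · simp only [laplacian, h₁', ← h₀, pd_const_mul (contDiff_pd hg 1), pd_comm hg 0 1, Pi.zero_apply]
    ring

namespace DeterminingEquations

lemma laplacian_zero_one (h : ∀ z, DeterminingEquations ε γ A ξ (B' z) z)
    (hξ : ContDiff ℝ ∞ ξ) :
    laplacian (fun w => ξ w 0) = 0 ∧ laplacian (fun w => ξ w 1) = 0 :=
  laplacian_eq_zero_of_cauchyRiemann (by fun_prop) (by fun_prop)
    (funext fun z => by linarith [(h z).pd_zero_zero, (h z).pd_one_one])
    (funext fun z => by rw [(h z).pd_one_zero, neg_one_mul])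

lemma pd_two_two_eq (h : ∀ z, DeterminingEquations ε γ A ξ (B' z) z) :
    pd 2 (fun w => ξ w 2) = fun z => 2 * pd 0 (fun w => ξ w 0) z := by
  funext z
  have h₀ : pd 0 (fun w => ξ w 2) = fun _ => 0 := funext fun z => (h z).pd_zero_two
  have h₁ : pd 1 (fun w => ξ w 2) = fun _ => 0 := funext fun z => (h z).pd_one_two
  have h₂ := (h z).pd_two_two
  simp only [laplacian, h₀, h₁, pd_const] at h₂
  linarith [(h z).pd_zero_zero]

lemma pd_coeff_eq_zero (h : ∀ z, DeterminingEquations ε γ A ξ (B' z) z) (hε : ε ≠ 0)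
    (hξ : ContDiff ℝ ∞ ξ) (i : Fin 3) : pd i A = fun _ => 0 := by
  have hX : pd 2 (fun w => ξ w 0) = fun _ => 0 := funext fun z => (h z).pd_two_zero
  have hT₀ : pd 0 (fun w => ξ w 2) = fun _ => 0 := funext fun z => (h z).pd_zero_two
  have hT₁ : pd 1 (fun w => ξ w 2) = fun _ => 0 := funext fun z => (h z).pd_one_two
  have hΔT : laplacian (fun w => ξ w 2) = fun _ => 0 := by
    funext z
    simp [laplacian, hT₀, hT₁, pd_const]
  have hA₀ : pd 0 A = fun _ => 0 := funext fun z => by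
    simpa [(laplacian_zero_one h hξ).1, hε, (h z).pd_two_zero, hT₀, pd_const]
      using (h z).pd_zero_coeff
  have hA₁ : pd 1 A = fun _ => 0 := funext fun z => by
    simpa [(laplacian_zero_one h hξ).2, hε, (h z).pd_two_one, hT₁, pd_const]
      using (h z).pd_one_coeff
  have hT₂₂ : pd 2 (pd 2 fun w => ξ w 2) = fun _ => 0 := by
    rw [pd_two_two_eq h, pd_const_mul (by fun_prop), pd_comm (by fun_prop), hX, pd_const]
    simp only [mul_zero]
  have hA₂ : pd 2 A = fun _ => 0 := funext fun z => by
    have hLT : viscoOp ε γ (fun w => ξ w 2) z = 0 := by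
      simp [viscoOp, hT₂₂, hΔT, pd_const]
    simpa [laplacian, hA₀, hA₁, hLT, pd_const] using (h z).pd_two_coeff
  fin_cases i
  exacts [hA₀, hA₁, hA₂]

lemma pd_zero_zero_eq_zero (h : ∀ z, DeterminingEquations ε γ A ξ (B' z) z) (hε : ε ≠ 0)
    (hγ : γ ≠ 0) (hξ : ContDiff ℝ ∞ ξ) : pd 0 (fun w => ξ w 0) = fun _ => 0 := by
  funext z
  have hX : pd 2 (fun w => ξ w 0) = fun _ => 0 := funext fun z => (h z).pd_two_zero
  have hX₀ : pd 2 (pd 0 fun w => ξ w 0) z = 0 := by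
    rw [pd_comm (by fun_prop), hX, pd_const]
  have hconstraint := (h z).constraint
  rw [pd_coeff_eq_zero h hε hξ, hX₀] at hconstraint
  refine (mul_eq_zero_iff_left hγ).1 ?_
  linear_combination (hconstraint + γ * (h z).pd_zero_zero
    - γ * congrFun (pd_two_two_eq h) z) / 2

lemma exists_eq_motionField (h : ∀ z, DeterminingEquations ε γ A ξ (B' z) z) (hε : ε ≠ 0)
    (hγ : γ ≠ 0) (hξ : ContDiff ℝ ∞ ξ) : ∃ a b c d, ξ = motionField a b c d := by
  have hX₀ := pd_zero_zero_eq_zero h hε hγ hξ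
  have hX₂ : pd 2 (fun w => ξ w 0) = fun _ => 0 := funext fun z => (h z).pd_two_zero
  have hX₁₁ : pd 1 (pd 1 fun w => ξ w 0) = fun _ => 0 := funext fun z => by
    simpa [laplacian, hX₀, pd_const] using congrFun (laplacian_zero_one h hξ).1 z
  have hY₁ : ∀ z, pd 1 (fun w => ξ w 1) z = 0 := fun z => by
    linarith [(h z).pd_zero_zero, (h z).pd_one_one, congrFun hX₀ z]
  obtain ⟨d, hd⟩ : ∃ d, ∀ z, pd 1 (fun w => ξ w 0) z = d :=
    ⟨_, eq_const_of_pd_eq_zero ((contDiff_pd (by fun_prop) _).differentiable (by simp))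
      fun i z => by
        fin_cases i
        · simp [pd_comm (contDiff_pi.1 hξ 0) 0 1, hX₀, pd_const]
        · simp [hX₁₁]
        · simp [pd_comm (contDiff_pi.1 hξ 0) 2 1, hX₂, pd_const]⟩
  have hY₀ : ∀ z, pd 0 (fun w => ξ w 1) z = -d := fun z => by
    rw [← hd z, (h z).pd_one_zero, neg_neg]
  have hX := eq_affine_of_pd_eq_const (contDiff_pi.1 hξ 0) ![0, d, 0] fun i z => by
    fin_cases i <;> simp [hX₀, hd, hX₂]
  have hY := eq_affine_of_pd_eq_const (contDiff_pi.1 hξ 1) ![-d, 0, 0] fun i z => by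
    fin_cases i <;> simp [hY₀, hY₁, (h z).pd_two_one]
  have hT := eq_affine_of_pd_eq_const (contDiff_pi.1 hξ 2) 0 fun i z => by
    fin_cases i <;> simp [(h z).pd_zero_two, (h z).pd_one_two, pd_two_two_eq h, hX₀]
  refine ⟨ξ 0 0, ξ 0 1, ξ 0 2, d, funext fun z => funext fun i => ?_⟩
  fin_cases i
  · simp [motionField, hX z]
  · simp [motionField, hY z, sub_eq_add_neg]
  · simp [motionField, hT z]

end DeterminingEquations

end DeterminingEquationsSolution

/-! ### Infinitesimal symmetries are combinations of the generators -/

section Classification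

variable {ε γ : ℝ} {V : Total → Total}

lemma IsInvariantOnSolutions.characteristicU_derivF (h : IsInvariantOnSolutions ε γ V)
    (hε : ε ≠ 0) (hV : ContDiff ℝ ∞ V) {u : Base → ℝ} (hu : ContDiff ℝ ∞ u) :
    characteristicU (derivF V) u (viscoOp ε γ u) = 0 := by
  have hf := contDiff_viscoOp (ε := ε) (γ := γ) hu
  exact funext fun z => eq_zero_of_linearisedSymbol_eq_zero hε
    (contDiff_characteristicU (by fun_prop) hu hf) (contDiff_characteristicU (by fun_prop) hu hf)
    (by fun_prop) (h.linearisedSymbol_eq_zero hV hu rfl z)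

lemma IsInvariantOnSolutions.determiningEquations (h : IsInvariantOnSolutions ε γ V)
    (hε : ε ≠ 0) (hV : ContDiff ℝ ∞ V) {u : Base → ℝ} (hu : ContDiff ℝ ∞ u) (z : Base) :
    DeterminingEquations ε γ (characteristicU (derivU V) u (viscoOp ε γ u))
      (fun w => (V (w, u w, viscoOp ε γ u w)).1)
      (characteristicF (derivF V) u (viscoOp ε γ u) z) z := by
  have hf := contDiff_viscoOp (ε := ε) (γ := γ) hu
  have hsymbol := h.linearisedSymbol_eq_zero hV hu rfl z
  rw [h.characteristicU_derivF hε hV hu] at hsymbol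
  exact .of_linearisedSymbol_eq_zero hε (contDiff_characteristicU (by fun_prop) hu hf)
    (by fun_prop) hsymbol

lemma IsInvariantOnSolutions.exists_eq_motionField_along (h : IsInvariantOnSolutions ε γ V)
    (hε : ε ≠ 0) (hγ : γ ≠ 0) (hV : ContDiff ℝ ∞ V) {u : Base → ℝ} (hu : ContDiff ℝ ∞ u) :
    ∃ a b c d, (fun w => (V (w, u w, viscoOp ε γ u w)).1) = motionField a b c d :=
  DeterminingEquations.exists_eq_motionField (h.determiningEquations hε hV hu) hε hγ
    (by fun_prop)

lemma IsInvariantOnSolutions.characteristicU_derivU_eq (h : IsInvariantOnSolutions ε γ V)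
    (hε : ε ≠ 0) (hV : ContDiff ℝ ∞ V) {u : Base → ℝ} (hu : ContDiff ℝ ∞ u) (z : Base) :
    characteristicU (derivU V) u (viscoOp ε γ u) z
      = characteristicU (derivU V) u (viscoOp ε γ u) 0 := by
  have hA := DeterminingEquations.pd_coeff_eq_zero (h.determiningEquations hε hV hu) hε
    (by fun_prop)
  refine eq_const_of_pd_eq_zero (ContDiff.differentiable (n := ∞) ?_ (by simp))
    (fun i z => congrFun (hA i) z) z
  exact contDiff_characteristicU (by fun_prop) hu (contDiff_viscoOp hu)

lemma exists_solution_interpolating (ε γ : ℝ) (z : Base) (a b a' b' : ℝ) :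
    ∃ u, ContDiff ℝ ∞ u ∧ u z = a ∧ viscoOp ε γ u z = b ∧
      u (z + Pi.single 2 1) = a' ∧ viscoOp ε γ u (z + Pi.single 2 1) = b' := by
  let cubic : Base → ℝ := fun w => a + (a' - a - b / 2 - (b' - b) / 6) * (w 2 - z 2)
    + b / 2 * ((w 2 - z 2) * (w 2 - z 2))
    + (b' - b) / 6 * ((w 2 - z 2) * ((w 2 - z 2) * (w 2 - z 2)))
  have hcubic : viscoOp ε γ cubic = fun w => b + (b' - b) * (w 2 - z 2) := by
    rw [viscoOp_eq (by fun_prop)]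
    simp (disch := fun_prop) only [cubic, pd_sub, pd_add, pd_const_mul, pd_mul, pd_const, pd_coord]
    funext w
    simp only [Fin.isValue, Fin.reduceEq, ↓reduceIte, sub_self, sub_zero, mul_zero, zero_mul,
      mul_one, one_mul, add_zero, zero_add]
    ring
  refine ⟨cubic, by fun_prop, by simp [cubic], by simp [hcubic], ?_, by simp [hcubic]⟩
  simp only [cubic, Pi.add_apply, Pi.single_eq_same]
  ring

lemma eq_of_forall_solution_add_single_two {β : Type*} {g : Total → β}
    (h : ∀ u, ContDiff ℝ ∞ u → ∀ z,
      g (z + Pi.single 2 1, u (z + Pi.single 2 1), viscoOp ε γ u (z + Pi.single 2 1))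
        = g (z, u z, viscoOp ε γ u z)) (p : Total) :
    g p = g (p.1, 0, 0) := by
  obtain ⟨u, hu, huz, hfz, huz', hfz'⟩ :=
    exists_solution_interpolating ε γ p.1 p.2.1 p.2.2 0 0
  have hsolution := h u hu p.1
  have hzero := h (fun _ => 0) contDiff_const p.1
  rw [huz, hfz, huz', hfz'] at hsolution
  rw [viscoOp_const 0] at hzero
  exact hsolution.symm.trans hzero

lemma IsInvariantOnSolutions.exists_fst_eq (h : IsInvariantOnSolutions ε γ V) (hε : ε ≠ 0)
    (hγ : γ ≠ 0) (hV : ContDiff ℝ ∞ V) :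
    ∃ a b c d, ∀ p, (V p).1 = motionField a b c d p.1 := by
  have hbase : ∀ p, (V p).1 = (V (p.1, 0, 0)).1 := by
    refine eq_of_forall_solution_add_single_two (ε := ε) (γ := γ) fun u hu z => ?_
    obtain ⟨a, b, c, d, hξ⟩ := h.exists_eq_motionField_along hε hγ hV hu
    rw [congrFun hξ z, congrFun hξ (z + Pi.single 2 1)]
    simp [motionField]
  obtain ⟨a, b, c, d, hξ⟩ := h.exists_eq_motionField_along hε hγ hV contDiff_const
  rw [viscoOp_const 0] at hξ
  exact ⟨a, b, c, d, fun p => (hbase p).trans (congrFun hξ p.1)⟩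

lemma fst_fderiv_eq_zero_of_fst_eq_comp (hV : Differentiable ℝ V) {M : Base → Base}
    (hM : Differentiable ℝ M) (hVM : ∀ p, (V p).1 = M p.1) (p : Total) (v : ℝ × ℝ) :
    (fderiv ℝ V p (0, v)).1 = 0 := by
  have hfst : (fderiv ℝ V p (0, v)).1 = fderiv ℝ (fun q => M q.1) p (0, v) := by
    simp [← hVM, fderiv.fst (hV p)]
  have hcomp : HasFDerivAt (fun q : Total => M q.1) _ p :=
    (hM p.1).hasFDerivAt.comp p hasFDerivAt_fst
  simp [hfst, hcomp.fderiv]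

lemma IsInvariantOnSolutions.fst_fderiv_eq_zero (h : IsInvariantOnSolutions ε γ V) (hε : ε ≠ 0)
    (hγ : γ ≠ 0) (hV : ContDiff ℝ ∞ V) (p : Total) (v : ℝ × ℝ) : (fderiv ℝ V p (0, v)).1 = 0 := by
  obtain ⟨a, b, c, d, hM⟩ := h.exists_fst_eq hε hγ hV
  exact fst_fderiv_eq_zero_of_fst_eq_comp (hV.differentiable (by simp))
    ((contDiff_motionField a b c d).differentiable (by simp)) hM p v

lemma IsInvariantOnSolutions.snd_fst_derivF_eq_zero (h : IsInvariantOnSolutions ε γ V)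
    (hε : ε ≠ 0) (hγ : γ ≠ 0) (hV : ContDiff ℝ ∞ V) (p : Total) : (derivF V p).2.1 = 0 := by
  obtain ⟨u, hu, huz, hfz, -, -⟩ := exists_solution_interpolating ε γ p.1 p.2.1 p.2.2 0 0
  have hB := congrFun (h.characteristicU_derivF hε hV hu) p.1
  simpa [characteristicU, huz, hfz, derivF, h.fst_fderiv_eq_zero hε hγ hV] using hB

lemma IsInvariantOnSolutions.snd_fst_derivU_eq (h : IsInvariantOnSolutions ε γ V) (hε : ε ≠ 0)
    (hγ : γ ≠ 0) (hV : ContDiff ℝ ∞ V) (p : Total) : (derivU V p).2.1 = (derivU V 0).2.1 := by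
  have hchar : ∀ u f z, characteristicU (derivU V) u f z = (derivU V (z, u z, f z)).2.1 :=
    fun u f z => by simp [characteristicU, derivU, h.fst_fderiv_eq_zero hε hγ hV]
  have hconst := fun u hu z => h.characteristicU_derivU_eq (u := u) hε hV hu z
  simp only [hchar] at hconst
  have hzero := hconst (fun _ => 0) contDiff_const p.1
  rw [viscoOp_const 0] at hzero
  exact (eq_of_forall_solution_add_single_two (ε := ε) (γ := γ) (g := fun q => (derivU V q).2.1)
    (fun u hu z => (hconst u hu _).trans (hconst u hu z).symm) p).trans hzero

lemma eq_mul_add_of_derivU_eq_const {g : Total → ℝ} (hg : Differentiable ℝ g) {k : ℝ}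
    (hU : ∀ p, derivU g p = k) (hF : ∀ p, derivF g p = 0) (p : Total) :
    g p = k * p.2.1 + g (p.1, 0, 0) := by
  have hline : ∀ s : ℝ, HasDerivAt
      (fun s : ℝ => g (p.1, 0 + s * p.2.1, 0 + s * p.2.2) - s * (p.2.1 * k)) 0 s := fun s => by
    simpa [hU, hF] using (hasDerivAt_comp_perturbation hg p.1 0 0 p.2.1 p.2.2 s).fun_sub
      ((hasDerivAt_id s).mul_const (p.2.1 * k))
  have hconst := is_const_of_deriv_eq_zero (fun s => (hline s).differentiableAt)
    (fun s => (hline s).deriv) 1 0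
  simp only [zero_add, one_mul, zero_mul, sub_zero] at hconst
  linarith

lemma IsInvariantOnSolutions.exists_snd_fst_eq (h : IsInvariantOnSolutions ε γ V) (hε : ε ≠ 0)
    (hγ : γ ≠ 0) (hV : ContDiff ℝ ∞ V) :
    ∃ k, ∀ p, (V p).2.1 = k * p.2.1 + (V (p.1, 0, 0)).2.1 := by
  have hVd := hV.differentiable (by simp)
  have hU : ∀ p, derivU (fun q => (V q).2.1) p = (derivU V 0).2.1 := fun p => by
    rw [← h.snd_fst_derivU_eq hε hγ hV p]
    simp [derivU, fderiv.fst, fderiv.snd, hVd.snd _, hVd _]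
  have hF : ∀ p, derivF (fun q => (V q).2.1) p = 0 := fun p => by
    rw [← h.snd_fst_derivF_eq_zero hε hγ hV p]
    simp [derivF, fderiv.fst, fderiv.snd, hVd.snd _, hVd _]
  exact ⟨_, eq_mul_add_of_derivU_eq_const hVd.snd.fst hU hF⟩

theorem IsInvariantOnSolutions.exists_eq_sum_X_add_Xα (h : IsInvariantOnSolutions ε γ V)
    (hε : ε ≠ 0) (hγ : γ ≠ 0) (hV : ContDiff ℝ ∞ V) :
    ∃ (c : Fin 5 → ℝ) (α : Base → ℝ), ContDiff ℝ ∞ α ∧ V = ∑ i, c i • X i + Xα ε γ α := by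
  obtain ⟨a, b, c, d, hξ⟩ := h.exists_fst_eq hε hγ hV
  obtain ⟨k, hφ⟩ := h.exists_snd_fst_eq hε hγ hV
  have hα : ContDiff ℝ ∞ fun z => (V (z, 0, 0)).2.1 := by fun_prop
  refine ⟨![a, b, c, d, k], _, hα, funext fun p => ?_⟩
  obtain ⟨u, hu, huz, hfz, -, -⟩ := exists_solution_interpolating ε γ p.1 p.2.1 p.2.2 0 0
  have hM := contDiff_motionField a b c d
  have hQ : characteristicU V u (viscoOp ε γ u) = fun w => k * u w + (V (w, 0, 0)).2.1
      - ∑ i, motionField a b c d w i * pd i u w := by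
    funext w
    simp only [characteristicU, hξ, hφ (w, u w, viscoOp ε γ u w)]
  have hinv := congrFun (h u hu) p.1
  rw [hQ, viscoOp_sub (by fun_prop) (by fun_prop), viscoOp_add (by fun_prop) hα,
    viscoOp_const_mul _ hu] at hinv
  simp only [viscoOp_sum_motionField_mul_pd _ _ _ _ hu, characteristicF, hξ, huz, hfz] at hinv
  rw [sum_X_add_Xα_apply]
  exact Prod.ext (hξ p) (Prod.ext (hφ p) (sub_left_injective hinv).symm)

end Classification

/-! ### One-parameter groups generated by the listed vector fields -/

section GroupsOfSymmetries

variable {ε γ : ℝ}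

/-- The rotation by the angle `-θ` in the `(x, y)`-plane followed by the translation by `b`. -/
noncomputable def motion (θ : ℝ) (b z : Base) : Base :=
  ![Real.cos θ * z 0 + Real.sin θ * z 1 + b 0, -Real.sin θ * z 0 + Real.cos θ * z 1 + b 1,
    z 2 + b 2]

lemma motion_zero_left (b z : Base) : motion 0 b z = z + b := by
  funext i
  fin_cases i <;> simp [motion]

@[fun_prop]
lemma contDiff_motion {E : Type*} [NormedAddCommGroup E] [NormedSpace ℝ E] {θ : E → ℝ}
    {b z : E → Base} (hθ : ContDiff ℝ ∞ θ) (hb : ContDiff ℝ ∞ b) (hz : ContDiff ℝ ∞ z) :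
    ContDiff ℝ ∞ fun x => motion (θ x) (b x) (z x) := by
  refine contDiff_pi.2 fun i => ?_
  fin_cases i <;> simp only [motion, Fin.zero_eta, Fin.mk_one, Fin.reduceFinMk,
    Matrix.cons_val] <;> fun_prop

lemma hasFDerivAt_motion (θ : ℝ) (b z : Base) :
    HasFDerivAt (motion θ b) (Matrix.toLin' !![Real.cos θ, Real.sin θ, 0;
      -Real.sin θ, Real.cos θ, 0; 0, 0, 1]).toContinuousLinearMap z := by
  set A : Base →L[ℝ] Base := (Matrix.toLin' !![Real.cos θ, Real.sin θ, 0;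
    -Real.sin θ, Real.cos θ, 0; 0, 0, 1]).toContinuousLinearMap with hA
  have hlinear : motion θ b = fun z => A z + b := by
    funext z i
    fin_cases i <;> simp [hA, motion, dotProduct, Fin.sum_univ_three]
  rw [hlinear]
  exact A.hasFDerivAt.add_const b

lemma pd_comp_motion {g : Base → ℝ} (hg : Differentiable ℝ g) (θ : ℝ) (b : Base) :
    (pd 0 (fun z => g (motion θ b z)) = fun z =>
        Real.cos θ * pd 0 g (motion θ b z) - Real.sin θ * pd 1 g (motion θ b z)) ∧
      (pd 1 (fun z => g (motion θ b z)) = fun z =>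
        Real.sin θ * pd 0 g (motion θ b z) + Real.cos θ * pd 1 g (motion θ b z)) ∧
      pd 2 (fun z => g (motion θ b z)) = fun z => pd 2 g (motion θ b z) := by
  have hcomp : ∀ z, HasFDerivAt (fun z => g (motion θ b z)) _ z := fun z =>
    (hg _).hasFDerivAt.comp z (hasFDerivAt_motion θ b z)
  refine ⟨?_, ?_, ?_⟩ <;> funext z <;> rw [pd, (hcomp z).fderiv] <;>
    simp [fderiv_eq_sum_pd, Fin.sum_univ_three, sub_eq_add_neg]

lemma viscoOp_comp_motion {g : Base → ℝ} (hg : ContDiff ℝ ∞ g) (θ : ℝ) (b z : Base) :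
    viscoOp ε γ (fun z => g (motion θ b z)) z = viscoOp ε γ g (motion θ b z) := by
  have h₀ := fun h (hh : ContDiff ℝ ∞ h) => (pd_comp_motion (hh.differentiable (by simp)) θ b).1
  have h₁ := fun h (hh : ContDiff ℝ ∞ h) => (pd_comp_motion (hh.differentiable (by simp)) θ b).2.1
  have h₂ := fun h (hh : ContDiff ℝ ∞ h) => (pd_comp_motion (hh.differentiable (by simp)) θ b).2.2
  rw [viscoOp_eq (by fun_prop), viscoOp_eq hg]
  simp (disch := fun_prop) only [h₀, h₁, h₂, pd_add, pd_sub, pd_const_mul]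
  simp (disch := fun_prop) only [pd_comm _ 1 0]
  linear_combination -(ε * (pd 2 (pd 0 (pd 0 g)) (motion θ b z)
    + pd 2 (pd 1 (pd 1 g)) (motion θ b z)) + γ * (pd 0 (pd 0 g) (motion θ b z)
    + pd 1 (pd 1 g) (motion θ b z))) * Real.cos_sq_add_sin_sq θ

/-- The point transformation that carries `(u, f)` to `(r u + α, r f + L α)`, moved by
`motion θ b`. -/
noncomputable def solutionMap (ε γ θ : ℝ) (b : Base) (r : ℝ) (α : Base → ℝ) (p : Total) : Total :=
  (motion θ b p.1, r * p.2.1 + α p.1, r * p.2.2 + viscoOp ε γ α p.1)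

lemma image_eq_graphOver_iff {Ψ : Total → Total} {u f u' f' : Base → ℝ} {Ω Ω' : Set Base} :
    Ψ '' graphOver u f Ω = graphOver u' f' Ω' ↔
      (fun z => (Ψ (z, u z, f z)).1) '' Ω = Ω' ∧ ∀ z ∈ Ω,
        (Ψ (z, u z, f z)).2 = (u' (Ψ (z, u z, f z)).1, f' (Ψ (z, u z, f z)).1) := by
  simp only [graphOver, Set.image_image]
  constructor
  · intro himage
    have hfst : Set.image (fun z => (Ψ (z, u z, f z)).1) Ω = Ω' := by
      simpa [Set.image_image] using congrArg (Set.image Prod.fst) himage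
    refine ⟨hfst, fun z hz => ?_⟩
    obtain ⟨w, -, hw⟩ := himage.subset (Set.mem_image_of_mem _ hz)
    rw [← hw]
  · rintro ⟨rfl, hval⟩
    rw [Set.image_image]
    exact Set.image_congr fun z hz => Prod.ext rfl (hval z hz)

lemma IsSolutionOn.of_image_solutionMap {θ r : ℝ} {b : Base} {α u f u' f' : Base → ℝ}
    {Ω Ω' : Set Base} (h : IsSolutionOn ε γ u f Ω) (hα : ContDiff ℝ ∞ α) (hΩ : IsOpen Ω)
    (hΩ' : IsOpen Ω') (hu' : ContDiffOn ℝ ∞ u' Ω') (hf' : ContDiffOn ℝ ∞ f' Ω')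
    (himage : solutionMap ε γ θ b r α '' graphOver u f Ω = graphOver u' f' Ω') :
    IsSolutionOn ε γ u' f' Ω' := by
  obtain ⟨rfl, hval⟩ := image_eq_graphOver_iff.1 himage
  refine ⟨hu', hf', ?_⟩
  rintro _ ⟨z, hz, rfl⟩
  simp only [solutionMap, Prod.mk.injEq] at hval ⊢
  obtain ⟨v', hv', hvu'⟩ := exists_contDiff_eventuallyEq hΩ' hu' (Set.mem_image_of_mem _ hz)
  obtain ⟨v, hv, hvu⟩ := exists_contDiff_eventuallyEq hΩ h.1 hz
  have hcomp : (fun y => v' (motion θ b y)) =ᶠ[𝓝 z] fun y => r * v y + α y := by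
    have hcont : Tendsto (motion θ b) (𝓝 z) (𝓝 (motion θ b z)) :=
      (contDiff_motion contDiff_const contDiff_const contDiff_id).continuous.continuousAt
    filter_upwards [hcont.eventually hvu', hvu, hΩ.mem_nhds hz] with y hy' hy hyΩ
    rw [hy', hy, (hval y hyΩ).1]
  calc viscoOp ε γ u' (motion θ b z) = viscoOp ε γ v' (motion θ b z) := viscoOp_congr hvu'.symm
    _ = viscoOp ε γ (fun y => r * v y + α y) z := by
      rw [← viscoOp_comp_motion hv', viscoOp_congr hcomp]
    _ = r * viscoOp ε γ v z + viscoOp ε γ α z := by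
      rw [viscoOp_add (by fun_prop) hα, viscoOp_const_mul r hv]
    _ = f' (motion θ b z) := by
      rw [viscoOp_congr hvu, h.2.2 z hz, (hval z hz).2]

lemma LocalOneParameterGroup.isSymmetryGroup_of_map_eq_solutionMap {Φ : LocalOneParameterGroup}
    (h : ∀ s, ∃ θ b r α, ContDiff ℝ ∞ α ∧ Φ.map s = solutionMap ε γ θ b r α) :
    Φ.IsSymmetryGroup ε γ := by
  intro s Ω Ω' u f u' f' hΩ hΩ' hsol _ hu' hf' himage
  obtain ⟨θ, b, r, α, hα, hmap⟩ := h s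
  exact hsol.of_image_solutionMap hα hΩ hΩ' hu' hf' (hmap ▸ himage)

/-- A smooth flow defined for all parameters and at all points, as a one-parameter group. -/
def LocalOneParameterGroup.ofFlow (map : ℝ → Total → Total)
    (smooth : ContDiff ℝ ∞ fun q : ℝ × Total => map q.1 q.2) (map_zero : ∀ p, map 0 p = p)
    (map_add : ∀ r s p, map s (map r p) = map (s + r) p) : LocalOneParameterGroup where
  dom := Set.univ
  map := map
  isOpen_dom := isOpen_univ
  zero_mem _ := trivial
  smooth := smooth.contDiffOn
  map_zero := map_zero
  map_add r s p _ _ _ := map_add r s p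
  neg_mem _ _ _ := trivial

variable (ε γ)

lemma exists_group_translation (b : Base) : ∃ Φ : LocalOneParameterGroup,
    Φ.dom = Set.univ ∧ Φ.IsSymmetryGroup ε γ ∧ Φ.generator = fun _ => (b, 0, 0) := by
  refine ⟨.ofFlow (fun s p => (p.1 + s • b, p.2)) (by fun_prop) (fun p => by simp)
    (fun r s p => by simp [add_smul, add_assoc, add_comm]), rfl, ?_, ?_⟩
  · refine LocalOneParameterGroup.isSymmetryGroup_of_map_eq_solutionMap fun s =>
      ⟨0, s • b, 1, fun _ => 0, contDiff_const, funext fun p => ?_⟩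
    simp [LocalOneParameterGroup.ofFlow, solutionMap, motion_zero_left, viscoOp_const 0]
  · funext p
    have hflow : HasDerivAt (fun s : ℝ => ((p.1 + s • b, p.2) : Total)) ((1 : ℝ) • b, 0, 0) 0 :=
      (((hasDerivAt_id (0 : ℝ)).smul_const b).const_add p.1).prodMk (hasDerivAt_const _ _)
    exact hflow.deriv.trans (by rw [one_smul])

lemma hasDerivAt_motion_zero (z : Base) :
    HasDerivAt (fun s => motion s 0 z) ![z 1, -z 0, 0] 0 := by
  have hcos : HasDerivAt Real.cos 0 0 := by simpa using Real.hasDerivAt_cos 0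
  have hsin : HasDerivAt Real.sin 1 0 := by simpa using Real.hasDerivAt_sin 0
  refine hasDerivAt_pi.2 fun i => ?_
  fin_cases i
  · simpa [motion] using (hcos.mul_const (z 0)).fun_add (hsin.mul_const (z 1))
  · simpa [motion] using (hsin.fun_neg.mul_const (z 0)).fun_add (hcos.mul_const (z 1))
  · simpa [motion] using hasDerivAt_const (0 : ℝ) (z 2)

lemma motion_motion (r s : ℝ) (z : Base) : motion s 0 (motion r 0 z) = motion (s + r) 0 z := by
  funext i
  fin_cases i <;> simp [motion, Real.cos_add, Real.sin_add] <;> ring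

lemma exists_group_rotation : ∃ Φ : LocalOneParameterGroup,
    Φ.dom = Set.univ ∧ Φ.IsSymmetryGroup ε γ ∧ Φ.generator = X₄ := by
  refine ⟨.ofFlow (fun s p => (motion s 0 p.1, p.2)) (by fun_prop)
    (fun p => by simp [motion_zero_left]) (fun r s p => by simp [motion_motion]), rfl, ?_, ?_⟩
  · refine LocalOneParameterGroup.isSymmetryGroup_of_map_eq_solutionMap fun s =>
      ⟨s, 0, 1, fun _ => 0, contDiff_const, funext fun p => ?_⟩
    simp [LocalOneParameterGroup.ofFlow, solutionMap, viscoOp_const 0]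
  · funext p
    exact ((hasDerivAt_motion_zero p.1).prodMk (hasDerivAt_const 0 p.2)).deriv

lemma exists_group_scaling : ∃ Φ : LocalOneParameterGroup,
    Φ.dom = Set.univ ∧ Φ.IsSymmetryGroup ε γ ∧ Φ.generator = X₅ := by
  refine ⟨.ofFlow (fun s p => (p.1, Real.exp s • p.2)) (by fun_prop) (fun p => by simp)
    (fun r s p => by simp [Real.exp_add, mul_smul]), rfl, ?_, ?_⟩
  · refine LocalOneParameterGroup.isSymmetryGroup_of_map_eq_solutionMap fun s =>
      ⟨0, 0, Real.exp s, fun _ => 0, contDiff_const, funext fun p => ?_⟩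
    simp [LocalOneParameterGroup.ofFlow, solutionMap, motion_zero_left, viscoOp_const 0,
      Prod.smul_def]
  · funext p
    have hflow : HasDerivAt (fun s : ℝ => ((p.1, Real.exp s • p.2) : Total))
        (0, Real.exp 0 • p.2) 0 :=
      (hasDerivAt_const _ _).prodMk ((Real.hasDerivAt_exp 0).smul_const p.2)
    exact hflow.deriv.trans (by simp [X₅])

lemma exists_group_superposition {α : Base → ℝ} (hα : ContDiff ℝ ∞ α) :
    ∃ Φ : LocalOneParameterGroup,
      Φ.dom = Set.univ ∧ Φ.IsSymmetryGroup ε γ ∧ Φ.generator = Xα ε γ α := by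
  refine ⟨.ofFlow (fun s p => p + s • Xα ε γ α p) (by simp only [Xα, verticalField]; fun_prop)
    (fun p => by simp)
    (fun r s p => by simp [Xα, verticalField, add_smul, add_assoc, add_comm]), rfl, ?_, ?_⟩
  · refine LocalOneParameterGroup.isSymmetryGroup_of_map_eq_solutionMap fun s =>
      ⟨0, 0, 1, fun z => s * α z, by fun_prop, funext fun p => ?_⟩
    rw [solutionMap, viscoOp_const_mul s hα]
    simp [LocalOneParameterGroup.ofFlow, motion_zero_left, Xα, verticalField, Prod.ext_iff]
  · funext p
    have hflow : HasDerivAt (fun s : ℝ => p + s • Xα ε γ α p) ((1 : ℝ) • Xα ε γ α p) 0 :=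
      ((hasDerivAt_id (0 : ℝ)).smul_const _).const_add p
    exact hflow.deriv.trans (one_smul ℝ _)

lemma exists_group_X (i : Fin 5) : ∃ Φ : LocalOneParameterGroup,
    Φ.dom = Set.univ ∧ Φ.IsSymmetryGroup ε γ ∧ Φ.generator = X i := by
  fin_cases i
  exacts [exists_group_translation ε γ _, exists_group_translation ε γ _,
    exists_group_translation ε γ _, exists_group_rotation ε γ, exists_group_scaling ε γ]

end GroupsOfSymmetries

/-! ### Commutators -/

/-- The linear part of the affine vector field `X i`. -/
noncomputable def linearPartX : Fin 5 → Total →L[ℝ] Total :=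
  ![0, 0, 0, (Matrix.toLin' !![0, 1, 0; -1, 0, 0; 0, 0, 0]).toContinuousLinearMap.prodMap 0,
    (0 : Base →L[ℝ] Base).prodMap (.id ℝ (ℝ × ℝ))]

lemma X_eq_linearPartX_add_const (i : Fin 5) : X i = fun p => linearPartX i p + X i 0 := by
  funext p
  fin_cases i <;> simp [X, X₁, X₂, X₃, X₄, X₅, linearPartX, Prod.ext_iff,
    Matrix.vecHead, Matrix.vecTail]

lemma fderiv_X (i : Fin 5) (p : Total) : fderiv ℝ (X i) p = linearPartX i := by
  rw [X_eq_linearPartX_add_const]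
  exact ((linearPartX i).hasFDerivAt.add_const _).fderiv

lemma lieBracket_X (i j : Fin 5) :
    VectorField.lieBracket ℝ (X i) (X j) = commutatorTable i j := by
  funext p
  rw [VectorField.lieBracket, fderiv_X, fderiv_X]
  fin_cases i <;> fin_cases j <;>
    simp [linearPartX, X, X₁, X₂, X₃, X₄, X₅, commutatorTable, Prod.ext_iff, funext_iff,
      Fin.forall_fin_succ, Matrix.vecHead, Matrix.vecTail]

/-! ### Generators of groups of point symmetries -/

lemma exists_openPartialHomeomorph_contDiffOn_symm {𝕜 E F : Type*} [RCLike 𝕜]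
    [NormedAddCommGroup E] [NormedSpace 𝕜 E] [CompleteSpace E] [NormedAddCommGroup F]
    [NormedSpace 𝕜 F] {n : WithTop ℕ∞} (hn : 1 ≤ n) {g : E → F} {D : Set E} (hD : IsOpen D)
    (hg : ContDiffOn 𝕜 n g D) {x : E} (hx : x ∈ D) (A : E ≃L[𝕜] F)
    (hA : HasFDerivAt g (A : E →L[𝕜] F) x) :
    ∃ e : OpenPartialHomeomorph E F, x ∈ e.source ∧ e.source ⊆ D ∧ (∀ y, e y = g y) ∧
      ContDiffOn 𝕜 n e.symm e.target := by
  have hn₀ : n ≠ 0 := (zero_lt_one.trans_le hn).ne'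
  have hgAt : ∀ y ∈ D, ContDiffAt 𝕜 n g y := fun y hy => hg.contDiffAt (hD.mem_nhds hy)
  let W : Set E := D ∩ fderiv 𝕜 g ⁻¹' Set.range ((↑) : (E ≃L[𝕜] F) → E →L[𝕜] F)
  have hW : IsOpen W :=
    (hg.continuousOn_fderiv_of_isOpen hD hn).isOpen_inter_preimage hD ContinuousLinearEquiv.isOpen
  let e := ((hgAt x hx).toOpenPartialHomeomorph g hA hn₀).restrOpen W hW
  refine ⟨e, ⟨(hgAt x hx).mem_toOpenPartialHomeomorph_source hA hn₀, hx, A, hA.fderiv.symm⟩,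
    fun y hy => hy.2.1, fun y => rfl, fun y hy => ContDiffAt.contDiffWithinAt ?_⟩
  obtain ⟨hyD, B, hB⟩ : e.symm y ∈ W := (e.map_target hy).2
  refine e.contDiffAt_symm hy (f₀' := B) ?_ (hgAt _ hyD)
  rw [hB]
  exact ((hgAt _ hyD).differentiableAt hn₀).hasFDerivAt

lemma exists_openPartialHomeomorph_of_slice_eq_id {E : Type*} [NormedAddCommGroup E]
    [NormedSpace ℝ E] [CompleteSpace E] {ξ : ℝ × E → E} {D : Set (ℝ × E)} (hD : IsOpen D)
    (hξ : ContDiffOn ℝ ∞ ξ D) (hξ₀ : ∀ z, ξ (0, z) = z) {z : E}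
    (hz : (0, z) ∈ D) :
    ∃ e : OpenPartialHomeomorph (ℝ × E) (ℝ × E), (0, z) ∈ e.source ∧ e.source ⊆ D ∧
      (∀ q, e q = (q.1, ξ q)) ∧ ContDiffOn ℝ ∞ e.symm e.target := by
  have hξd : HasFDerivAt ξ (fderiv ℝ ξ (0, z)) (0, z) :=
    ((hξ.contDiffAt (hD.mem_nhds hz)).differentiableAt (by simp)).hasFDerivAt
  have hslice : (fderiv ℝ ξ (0, z)).comp (.inr ℝ ℝ E) = .id ℝ E := by
    refine HasFDerivAt.unique ?_ (hasFDerivAt_id z)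
    exact (funext hξ₀ : (fun z => ξ (0, z)) = id) ▸ hξd.comp z (hasFDerivAt_prodMk_right 0 z)
  refine exists_openPartialHomeomorph_contDiffOn_symm (by simp) hD (contDiffOn_fst.prodMk hξ) hz
    (.skewProd (.refl ℝ ℝ) (.refl ℝ E) ((fderiv ℝ ξ (0, z)).comp (.inl ℝ ℝ E))) ?_
  refine (hasFDerivAt_fst.prodMk hξd).congr_fderiv (ContinuousLinearMap.ext fun v => ?_)
  have hv : fderiv ℝ ξ (0, z) (0, v.2) = v.2 := DFunLike.congr_fun hslice v.2
  refine Prod.ext rfl ?_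
  calc fderiv ℝ ξ (0, z) v = fderiv ℝ ξ (0, z) (0, v.2) + fderiv ℝ ξ (0, z) (v.1, 0) := by
        rw [← map_add]
        simp
    _ = v.2 + fderiv ℝ ξ (0, z) (v.1, 0) := by rw [hv]

lemma image_slice_source_eq {T E : Type*} [TopologicalSpace T] [TopologicalSpace E]
    {ξ : T × E → E} {e : OpenPartialHomeomorph (T × E) (T × E)} (he : ∀ q, e q = (q.1, ξ q))
    (s : T) :
    (fun z => ξ (s, z)) '' (Prod.mk s ⁻¹' e.source) = Prod.mk s ⁻¹' e.target := by
  ext w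
  constructor
  · rintro ⟨z, hz, rfl⟩
    simpa [he] using e.map_source hz
  · intro hw
    have hright : ((e.symm (s, w)).1, ξ (e.symm (s, w))) = (s, w) := he _ ▸ e.right_inv hw
    obtain ⟨hfst, hsnd⟩ := Prod.mk.inj hright
    have hsymm : (s, (e.symm (s, w)).2) = e.symm (s, w) := Prod.ext hfst.symm rfl
    refine ⟨(e.symm (s, w)).2, ?_, ?_⟩
    · rw [Set.mem_preimage, hsymm]
      exact e.map_target hw
    · exact (congrArg ξ hsymm).trans hsnd

lemma paramDeriv_eq_sub_sum_mul_pd {F : Type*} [NormedAddCommGroup F] [NormedSpace ℝ F]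
    {R : ℝ × Base → ℝ} (hR : Differentiable ℝ R) (l : F →L[ℝ] ℝ) {g : Base → F}
    {Y : ℝ × Base → Base × F} (hY₀ : ∀ z, Y (0, z) = (z, g z)) {w : Base} {Y' : Base × F}
    (hY : HasDerivAt (fun s => Y (s, w)) Y' 0)
    (hRY : ∀ᶠ q in 𝓝 (0, w), R (q.1, (Y q).1) = l (Y q).2) :
    paramDeriv R (0, w) = l Y'.2 - ∑ i, Y'.1 i * pd i (fun z => l (g z)) w := by
  have hdR : HasFDerivAt R (fderiv ℝ R (0, w)) (0, (Y (0, w)).1) := by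
    rw [hY₀]
    exact (hR _).hasFDerivAt
  have hbase : HasDerivAt (fun s => (Y (s, w)).1) Y'.1 0 :=
    (ContinuousLinearMap.fst ℝ Base F).hasFDerivAt.comp_hasDerivAt (0 : ℝ) hY
  have hchain : HasDerivAt (fun s => R (s, (Y (s, w)).1)) (fderiv ℝ R (0, w) (1, Y'.1)) 0 :=
    hdR.comp_hasDerivAt (0 : ℝ) ((hasDerivAt_id (0 : ℝ)).prodMk hbase)
  have hvalue : HasDerivAt (fun s => l (Y (s, w)).2) (l Y'.2) 0 :=
    (l.comp (.snd ℝ Base F)).hasFDerivAt.comp_hasDerivAt (0 : ℝ) hY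
  have htotal : fderiv ℝ R (0, w) (1, Y'.1) = l Y'.2 :=
    hchain.unique (hvalue.congr_of_eventuallyEq
      ((Continuous.prodMk_left w).continuousAt.eventually hRY))
  have hslice : (fun z => R (0, z)) =ᶠ[𝓝 w] fun z => l (g z) := by
    filter_upwards [(Continuous.prodMk_right (0 : ℝ)).continuousAt.eventually hRY] with z hz
    simpa [hY₀] using hz
  have hspace : fderiv ℝ R (0, w) (0, Y'.1) = ∑ i, Y'.1 i * pd i (fun z => l (g z)) w := by
    rw [← fderiv_slice hR, hslice.fderiv_eq, fderiv_eq_sum_pd]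
  rw [← htotal, ← hspace, ← map_sub]
  simp [paramDeriv]

namespace LocalOneParameterGroup

variable {Φ : LocalOneParameterGroup}

lemma hasDerivAt_map (Φ : LocalOneParameterGroup) (p : Total) :
    HasDerivAt (fun s => Φ.map s p)
      (fderiv ℝ (fun q : ℝ × Total => Φ.map q.1 q.2) (0, p) (1, 0)) 0 := by
  have hmap := ((Φ.smooth.contDiffAt (Φ.isOpen_dom.mem_nhds (Φ.zero_mem p))).differentiableAt
    (by simp)).hasFDerivAt
  exact hmap.comp_hasDerivAt (0 : ℝ) ((hasDerivAt_id (0 : ℝ)).prodMk (hasDerivAt_const _ p))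

lemma hasDerivAt_generator (Φ : LocalOneParameterGroup) (p : Total) :
    HasDerivAt (fun s => Φ.map s p) (Φ.generator p) 0 :=
  (Φ.hasDerivAt_map p).differentiableAt.hasDerivAt

lemma contDiff_generator (Φ : LocalOneParameterGroup) : ContDiff ℝ ∞ Φ.generator := by
  have hgenerator : Φ.generator =
      fun p => fderiv ℝ (fun q : ℝ × Total => Φ.map q.1 q.2) (0, p) (1, 0) :=
    funext fun p => (Φ.hasDerivAt_map p).deriv
  rw [hgenerator, contDiff_iff_contDiffAt]
  intro p
  have hfderiv := (Φ.smooth.fderiv_of_isOpen Φ.isOpen_dom (m := ∞) (by simp)).contDiffAt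
    (Φ.isOpen_dom.mem_nhds (Φ.zero_mem p))
  exact (hfderiv.comp p (contDiffAt_const.prodMk contDiffAt_id)).clm_apply contDiffAt_const

/-- The point `Φ_s(z, u(z), f(z))` of the transformed graph, as a function of `(s, z)`. -/
def alongGraph (Φ : LocalOneParameterGroup) (u f : Base → ℝ) (q : ℝ × Base) : Total :=
  Φ.map q.1 (q.2, u q.2, f q.2)

variable {u f : Base → ℝ}

lemma alongGraph_zero (z : Base) : Φ.alongGraph u f (0, z) = (z, u z, f z) :=
  Φ.map_zero _

lemma hasDerivAt_alongGraph (Φ : LocalOneParameterGroup) (u f : Base → ℝ) (z : Base) :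
    HasDerivAt (fun s => Φ.alongGraph u f (s, z)) (Φ.generator (z, u z, f z)) 0 :=
  Φ.hasDerivAt_generator (z, u z, f z)

lemma exists_isOpen_contDiffOn_alongGraph (Φ : LocalOneParameterGroup) (hu : ContDiff ℝ ∞ u)
    (hf : ContDiff ℝ ∞ f) : ∃ D : Set (ℝ × Base), IsOpen D ∧ (∀ z, (0, z) ∈ D) ∧
      (∀ q ∈ D, (q.1, ((q.2, u q.2, f q.2) : Total)) ∈ Φ.dom) ∧
      ContDiffOn ℝ ∞ (Φ.alongGraph u f) D := by
  have hgraph : ContDiff ℝ ∞ fun q : ℝ × Base => (q.1, ((q.2, u q.2, f q.2) : Total)) := by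
    fun_prop
  exact ⟨_, Φ.isOpen_dom.preimage hgraph.continuous, fun z => Φ.zero_mem _, fun q hq => hq,
    Φ.smooth.comp hgraph.contDiffOn fun q hq => hq⟩

variable {ε γ : ℝ}

lemma IsSymmetryGroup.viscoOp_alongGraph_symm (hΦ : Φ.IsSymmetryGroup ε γ)
    (hu : ContDiff ℝ ∞ u) {e : OpenPartialHomeomorph (ℝ × Base) (ℝ × Base)}
    (he : ∀ q, e q = (q.1, (Φ.alongGraph u (viscoOp ε γ u) q).1))
    (hdom : ∀ q ∈ e.source, (q.1, ((q.2, u q.2, viscoOp ε γ u q.2) : Total)) ∈ Φ.dom)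
    (hsmooth : ContDiffOn ℝ ∞ (fun q => Φ.alongGraph u (viscoOp ε γ u) (e.symm q)) e.target)
    {s : ℝ} {w : Base} (hw : (s, w) ∈ e.target) :
    viscoOp ε γ (fun w => (Φ.alongGraph u (viscoOp ε γ u) (e.symm (s, w))).2.1) w
      = (Φ.alongGraph u (viscoOp ε γ u) (e.symm (s, w))).2.2 := by
  have hslice : Continuous (Prod.mk s : Base → ℝ × Base) := Continuous.prodMk_right s
  have hsmooth_s : ContDiffOn ℝ ∞ (fun w => Φ.alongGraph u (viscoOp ε γ u) (e.symm (s, w)))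
      (Prod.mk s ⁻¹' e.target) :=
    hsmooth.comp (contDiff_const.prodMk contDiff_id).contDiffOn fun w hw => hw
  refine (hΦ s (Prod.mk s ⁻¹' e.source) (Prod.mk s ⁻¹' e.target) u (viscoOp ε γ u)
    (fun w => (Φ.alongGraph u (viscoOp ε γ u) (e.symm (s, w))).2.1)
    (fun w => (Φ.alongGraph u (viscoOp ε γ u) (e.symm (s, w))).2.2)
    (e.open_source.preimage hslice) (e.open_target.preimage hslice)
    ⟨hu.contDiffOn, (contDiff_viscoOp hu).contDiffOn, fun z _ => rfl⟩ (fun z hz => hdom _ hz)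
    hsmooth_s.snd.fst hsmooth_s.snd.snd ?_).2.2 w hw
  refine image_eq_graphOver_iff.2 ⟨image_slice_source_eq he s, fun z hz => ?_⟩
  have hleft : e.symm (s, (Φ.alongGraph u (viscoOp ε γ u) (s, z)).1) = (s, z) := by
    rw [← he (s, z), e.left_inv hz]
  exact congrArg (fun q => (Φ.alongGraph u (viscoOp ε γ u) q).2) hleft.symm

lemma IsSymmetryGroup.exists_family_of_solutions (hΦ : Φ.IsSymmetryGroup ε γ)
    (hu : ContDiff ℝ ∞ u) (z₀ : Base) :
    ∃ U G : ℝ × Base → ℝ, ContDiff ℝ ∞ U ∧ ContDiff ℝ ∞ G ∧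
      (∀ᶠ q in 𝓝 (0, z₀), viscoOp ε γ (fun w => U (q.1, w)) q.2 = G q) ∧
      ∀ᶠ q in 𝓝 (0, z₀), Φ.alongGraph u (viscoOp ε γ u) q =
        ((Φ.alongGraph u (viscoOp ε γ u) q).1,
          U (q.1, (Φ.alongGraph u (viscoOp ε γ u) q).1),
          G (q.1, (Φ.alongGraph u (viscoOp ε γ u) q).1)) := by
  set Ψ := Φ.alongGraph u (viscoOp ε γ u)
  obtain ⟨D, hD, hzero, hdom, hsmooth⟩ :=
    Φ.exists_isOpen_contDiffOn_alongGraph hu (contDiff_viscoOp (ε := ε) (γ := γ) hu)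
  obtain ⟨e, hsource, hsub, he, hsymm⟩ := exists_openPartialHomeomorph_of_slice_eq_id hD
    hsmooth.fst (fun z => congrArg Prod.fst (alongGraph_zero z)) (hzero z₀)
  have hK : ContDiffOn ℝ ∞ (fun q => Ψ (e.symm q)) e.target :=
    hsmooth.comp hsymm fun q hq => hsub (e.map_target hq)
  have he₀ : e (0, z₀) = (0, z₀) := by rw [he, alongGraph_zero]
  have htarget : (0, z₀) ∈ e.target := he₀ ▸ e.map_source hsource
  obtain ⟨U, hU, hUK⟩ := exists_contDiff_eventuallyEq e.open_target hK.snd.fst htarget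
  obtain ⟨G, hG, hGK⟩ := exists_contDiff_eventuallyEq e.open_target hK.snd.snd htarget
  refine ⟨U, G, hU, hG, ?_, ?_⟩
  · filter_upwards [hUK.eventually_nhds, hGK, e.open_target.mem_nhds htarget]
      with ⟨s, w⟩ hUs hGs hs
    rw [hGs, ← hΦ.viscoOp_alongGraph_symm hu he (fun q hq => hdom q (hsub hq)) hK hs]
    exact viscoOp_congr ((Continuous.prodMk_right s).continuousAt.eventually hUs)
  · have hcont : Tendsto e (𝓝 (0, z₀)) (𝓝 (0, z₀)) := by
      simpa only [ContinuousAt, he₀] using e.continuousAt hsource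
    filter_upwards [hcont.eventually hUK, hcont.eventually hGK, e.open_source.mem_nhds hsource]
      with q hUq hGq hq
    rw [← he q, hUq, hGq, e.left_inv hq]

lemma IsSymmetryGroup.isInvariantOnSolutions (hΦ : Φ.IsSymmetryGroup ε γ) :
    IsInvariantOnSolutions ε γ Φ.generator := by
  intro u hu
  funext z₀
  obtain ⟨U, G, hU, hG, hsol, hgraph⟩ := hΦ.exists_family_of_solutions hu z₀
  have hUd := hU.differentiable (by simp)
  have hGd := hG.differentiable (by simp)
  have hcharU : (fun w => paramDeriv U (0, w)) =ᶠ[𝓝 z₀]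
      characteristicU Φ.generator u (viscoOp ε γ u) := by
    filter_upwards [(Continuous.prodMk_right (0 : ℝ)).continuousAt.eventually
      hgraph.eventually_nhds] with w hw
    exact paramDeriv_eq_sub_sum_mul_pd hUd (.fst ℝ ℝ ℝ) alongGraph_zero
      (Φ.hasDerivAt_alongGraph u _ _)
      (hw.mono fun q hq => (congrArg (fun p : Total => p.2.1) hq).symm)
  have hcharF : paramDeriv G (0, z₀) = characteristicF Φ.generator u (viscoOp ε γ u) z₀ :=
    paramDeriv_eq_sub_sum_mul_pd hGd (.snd ℝ ℝ ℝ) alongGraph_zero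
      (Φ.hasDerivAt_alongGraph u _ _)
      (hgraph.mono fun q hq => (congrArg (fun p : Total => p.2.2) hq).symm)
  rw [← viscoOp_congr hcharU, ← hcharF]
  exact (hasDerivAt_viscoOp_slice hU (fun w => hasDerivAt_slice hUd 0 w) z₀).unique
    ((hasDerivAt_slice hGd 0 z₀).congr_of_eventuallyEq
      ((Continuous.prodMk_left z₀).continuousAt.eventually hsol))

end LocalOneParameterGroup

end Viscoelastic

theorem mainTheorem2 (ε γ : ℝ) (hε : ε ≠ 0) (hγ : γ ≠ 0) :
    -- the infinitesimal symmetries are exactly the combinations of the listed vector fields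
    (∀ V : Total → Total, ContDiff ℝ ∞ V →
      (IsInfinitesimalSymmetry ε γ V ↔
        ∃ (c : Fin 5 → ℝ) (α : Base → ℝ), ContDiff ℝ ∞ α ∧ V = ∑ i, c i • X i + Xα ε γ α)) ∧
    -- every local one-parameter group of point symmetries is generated by such a combination
    (∀ Φ : LocalOneParameterGroup, Φ.IsSymmetryGroup ε γ →
      ∃ (c : Fin 5 → ℝ) (α : Base → ℝ), ContDiff ℝ ∞ α ∧
        Φ.generator = ∑ i, c i • X i + Xα ε γ α) ∧
    -- each listed vector field generates a global one-parameter group of point symmetries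
    (∀ i : Fin 5, ∃ Φ : LocalOneParameterGroup,
      Φ.dom = Set.univ ∧ Φ.IsSymmetryGroup ε γ ∧ Φ.generator = X i) ∧
    (∀ α : Base → ℝ, ContDiff ℝ ∞ α → ∃ Φ : LocalOneParameterGroup,
      Φ.dom = Set.univ ∧ Φ.IsSymmetryGroup ε γ ∧ Φ.generator = Xα ε γ α) ∧
    -- `α ∂_u` itself is a symmetry exactly if `α` solves the homogeneous equation
    (∀ α : Base → ℝ, ContDiff ℝ ∞ α →
      (IsInfinitesimalSymmetry ε γ (verticalField α 0) ↔ ∀ z, viscoOp ε γ α z = 0)) ∧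
    -- the commutators
    (∀ i j : Fin 5, VectorField.lieBracket ℝ (X i) (X j) = commutatorTable i j) := by
  refine ⟨fun V hV => ⟨fun h => (h.isInvariantOnSolutions hV).exists_eq_sum_X_add_Xα hε hγ hV, ?_⟩,
    fun Φ hΦ => hΦ.isInvariantOnSolutions.exists_eq_sum_X_add_Xα hε hγ Φ.contDiff_generator,
    exists_group_X ε γ, fun α hα => exists_group_superposition ε γ hα,
    fun α hα => isInfinitesimalSymmetry_verticalField_iff hα contDiff_const, lieBracket_X⟩
  rintro ⟨c, α, hα, rfl⟩
  exact isInfinitesimalSymmetry_sum_X_add_Xα c hα
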